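/- Let $\mathbb D$ be the open unit disk of $\mathbb C$, $dA = dx\,dy/\pi$ the normalized area measure on $\mathbb D$ and $dm = dt/2\pi$ the normalized Lebesgue measure on the unit circle $\mathbb T$. Consider the following Hilbert spaces of analytic functions $f\colon\mathbb D\to\mathbb C$, namely those for which the stated norm is finite: the Bergman space $\mathfrak B^2$, $\|f\|_{\mathfrak B^2}^2=\int_{\mathbb D}|f|^2\,dA$; the Hardy space $H^2$, $\|f\|_{H^2}^2=\sup_{0<r<1}\int_{\mathbb T}|f(r\xi)|^2\,dm(\xi)$; the Dirichlet space $\mathcal D^2$, $\|f\|_{\mathcal D^2}^2=|f(0)|^2+\int_{\mathbb D}|f'|^2\,dA$. For an analytic map $\varphi\colon\mathbb D\to\mathbb D$ let $C_\varphi f=f\circ\varphi$. For $j\ge 1$ and each of these spaces $H$, let $a_j^{H}(C_\varphi)=\inf\{\|C_\varphi-R\| : R \text{ a bounded operator on } H,\ \operatorname{rank}R<j\}$ if $C_\varphi$ is a bounded operator on $H$, and $a_j^{H}(C_\varphi)=+\infty$ otherwise. For $p>0$, $C_\varphi\in S_p(H)$ means that $C_\varphi$ is compact on $H$ and $\sum_{j\ge1}a_j^H(C_\varphi)^p<\infty$.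 **Theorem 3.1.** For every analytic $\varphi\colon\mathbb D\to\mathbb D$, $C_\varphi$ is bounded on $H^2$ and on $\mathfrak B^2$, and: 1. If $\varphi(0)=0$, then for every $n\ge1$ $$\prod_{j=1}^n a_j^{\mathfrak B^2}(C_\varphi)\le\prod_{j=1}^n a_j^{H^2}(C_\varphi)\le\prod_{j=1}^n a_j^{\mathcal D^2}(C_\varphi).$$ The second inequality also holds when $\mathcal D^2$ is given the equivalent norm $\big(\|f\|_{H^2}^2+\int_{\mathbb D}|f'|^2\,dA\big)^{1/2}$. 2. For every $a\in\mathbb D$ there is a finite constant $K$, depending only on $a$, such that for every analytic $\varphi\colon\mathbb D\to\mathbb D$ with $\varphi(0)=a$ and every $n\ge1$ $$\prod_{j=1}^n a_j^{\mathfrak B^2}(C_\varphi)\le K^n\prod_{j=1}^n a_j^{H^2}(C_\varphi),\qquad \prod_{j=1}^n a_j^{H^2}(C_\varphi)\le K^n\prod_{j=1}^n a_j^{\mathcal D^2}(C_\varphi),$$ the latter for either of the two norms on $\mathcal D^2$. 3. For every analytic $\varphi\colon\mathbb D\to\mathbb D$ (with no condition on $\varphi(0)$): if $C_\varphi$ is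 compact on $\mathcal D^2$, it is compact on $H^2$; if $C_\varphi$ is compact on $H^2$, it is compact on $\mathfrak B^2$; and for every $p>0$, $C_\varphi\in S_p(\mathcal D^2)$ implies $C_\varphi\in S_p(H^2)$, and $C_\varphi\in S_p(H^2)$ implies $C_\varphi\in S_p(\mathfrak B^2)$. -/

import Mathlib

open MeasureTheory
open scoped ENNReal NNReal

noncomputable section

namespace CompDisk

/-- The open unit disk of `ℂ`. -/
def disk : Set ℂ := Metric.ball 0 1

lemma isOpen_disk : IsOpen disk := Metric.isOpen_ball

/-- The space of analytic functions on the unit disk. A function on the disk is represented by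
its extension by `0` to `ℂ`, so that two elements are equal iff they agree on the disk. -/
def Hol : Submodule ℂ (ℂ → ℂ) where
  carrier := {f | DifferentiableOn ℂ f disk ∧ ∀ z, z ∉ disk → f z = 0}
  add_mem' := by
    rintro f g ⟨hf, hf'⟩ ⟨hg, hg'⟩
    exact ⟨hf.add hg, fun z hz => by simp [hf' z hz, hg' z hz]⟩
  zero_mem' := ⟨differentiableOn_const 0, fun _ _ => rfl⟩
  smul_mem' := by
    rintro c f ⟨hf, hf'⟩
    exact ⟨hf.const_smul c, fun z hz => by simp [hf' z hz]⟩

/-- An analytic self-map of the unit disk. -/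
structure SelfMap where
  toFun : ℂ → ℂ
  analytic : DifferentiableOn ℂ toFun disk
  mapsTo : Set.MapsTo toFun disk disk

/-- The composition map `f ↦ f ∘ φ` on analytic functions on the disk. -/
def comp (φ : SelfMap) : Hol →ₗ[ℂ] Hol where
  toFun f := ⟨disk.indicator fun z => (f : ℂ → ℂ) (φ.toFun z), by
    refine ⟨?_, fun z hz => Set.indicator_of_notMem hz _⟩
    exact (f.2.1.comp φ.analytic φ.mapsTo).congr fun z hz => Set.indicator_of_mem hz _⟩
  map_add' f g := by
    ext z
    by_cases hz : z ∈ disk <;> simp [hz]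
  map_smul' c f := by
    ext z
    by_cases hz : z ∈ disk <;> simp [hz]

/-! ### Normed spaces of analytic functions given by an extended norm -/

/-- A norm with values in `[0, ∞]` on the analytic functions on the disk, given through its
square. -/
structure ExtNorm where
  sq : Hol → ℝ≥0∞
  sq_smul : ∀ (c : ℂ) (f : Hol), sq (c • f) = ‖c‖ₑ ^ 2 * sq f
  triangle : ∀ f g : Hol,
    sq (f + g) ^ (1 / 2 : ℝ) ≤ sq f ^ (1 / 2 : ℝ) + sq g ^ (1 / 2 : ℝ)
  eq_zero : ∀ f : Hol, sq f = 0 → f = 0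

namespace ExtNorm

variable (N : ExtNorm)

/-- The (square root) norm, with values in `[0, ∞]`. -/
def root (f : Hol) : ℝ≥0∞ := N.sq f ^ (1 / 2 : ℝ)

lemma root_smul (c : ℂ) (f : Hol) : N.root (c • f) = ‖c‖ₑ * N.root f := by
  unfold root
  rw [N.sq_smul, ENNReal.mul_rpow_of_nonneg _ _ (by norm_num), ← ENNReal.rpow_natCast,
    ← ENNReal.rpow_mul]
  norm_num

lemma root_zero : N.root 0 = 0 := by
  have h := N.root_smul 0 0
  simpa using h

/-- The analytic functions on the disk with finite norm. -/
def finite : Submodule ℂ Hol where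
  carrier := {f | N.root f ≠ ∞}
  add_mem' := by
    intro f g hf hg
    exact ne_top_of_le_ne_top (ENNReal.add_ne_top.2 ⟨hf, hg⟩) (N.triangle f g)
  zero_mem' := by
    change N.root 0 ≠ ∞
    simp [root_zero]
  smul_mem' := by
    intro c f hf
    change N.root (c • f) ≠ ∞
    rw [root_smul]
    exact ENNReal.mul_ne_top (by simp) hf

/-- The space of the analytic functions on the disk with finite norm, with that norm. (A type
synonym, so that it does not carry the topology of pointwise convergence.) -/
def Space : Type := N.finite

instance : AddCommGroup N.Space := inferInstanceAs (AddCommGroup N.finite)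

instance : Module ℂ N.Space := inferInstanceAs (Module ℂ N.finite)

variable {N}

/-- The analytic function underlying an element of the space. -/
def Space.toHol : N.Space →ₗ[ℂ] Hol := N.finite.subtype

lemma Space.root_ne_top (f : N.Space) : N.root (toHol f) ≠ ∞ := Subtype.property f

lemma Space.toHol_injective : Function.Injective (toHol : N.Space → Hol) :=
  Subtype.val_injective

instance : NormedAddCommGroup N.Space :=
  AddGroupNorm.toNormedAddCommGroup
    { toFun := fun f => (N.root f.toHol).toReal
      map_zero' := by simp [root_zero]
      add_le' := fun f g => by
        rw [map_add, ← ENNReal.toReal_add f.root_ne_top g.root_ne_top]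
        exact ENNReal.toReal_mono (ENNReal.add_ne_top.2 ⟨f.root_ne_top, g.root_ne_top⟩)
          (N.triangle f.toHol g.toHol)
      neg' := fun f => by
        rw [← neg_one_smul ℂ f, map_smul, root_smul]
        simp
      eq_zero_of_map_eq_zero' := fun f hf => by
        have h := ((ENNReal.toReal_eq_zero_iff _).1 hf).resolve_right f.root_ne_top
        have h' := (ENNReal.rpow_eq_zero_iff_of_pos (by norm_num)).1 h
        exact Space.toHol_injective ((N.eq_zero _ h').trans (map_zero _).symm) }

lemma Space.norm_def (f : N.Space) : ‖f‖ = (N.root f.toHol).toReal := rfl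

instance : NormedSpace ℂ N.Space where
  norm_smul_le c f := by
    rw [Space.norm_def, Space.norm_def, map_smul, root_smul, ENNReal.toReal_mul]
    simp

end ExtNorm

/-! ### Approximation numbers, compactness, Schatten classes -/

/-- The `n`-th approximation number (`n ≥ 1`) of a bounded operator: the infimum of `‖T - R‖` over
the bounded operators `R` of rank `< n`. -/
def approxNumber {E : Type*} [NormedAddCommGroup E] [NormedSpace ℂ E] (T : E →L[ℂ] E) (n : ℕ) :
    ℝ≥0∞ :=
  ⨅ (R : E →L[ℂ] E) (_ : LinearMap.rank (R : E →ₗ[ℂ] E) < n), ‖T - R‖ₑ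

/-- `T` is the composition operator `C_φ` acting as a bounded operator on the space of `N`.
There is at most one such `T`. -/
def IsCompOp (N : ExtNorm) (φ : SelfMap) (T : N.Space →L[ℂ] N.Space) : Prop :=
  ∀ f : N.Space, (T f).toHol = comp φ f.toHol

/-- `C_φ` is a bounded operator on the space of `N`. -/
def CompBounded (N : ExtNorm) (φ : SelfMap) : Prop :=
  ∃ T : N.Space →L[ℂ] N.Space, IsCompOp N φ T

/-- `C_φ` is a compact operator on the space of `N`. -/
def CompCompact (N : ExtNorm) (φ : SelfMap) : Prop :=
  ∃ T : N.Space →L[ℂ] N.Space, IsCompOp N φ T ∧ IsCompactOperator T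

/-- `C_φ` belongs to the Schatten class `S_p` of the space of `N`. -/
def CompSchatten (N : ExtNorm) (p : ℝ) (φ : SelfMap) : Prop :=
  ∃ T : N.Space →L[ℂ] N.Space, IsCompOp N φ T ∧ IsCompactOperator T ∧
    ∑' n : ℕ, approxNumber T (n + 1) ^ p < ∞

/-- The `n`-th approximation number of `C_φ` on the space of `N`; it is `∞` if `C_φ` is not a
bounded operator there (infimum over an empty family). -/
def compApprox (N : ExtNorm) (φ : SelfMap) (n : ℕ) : ℝ≥0∞ :=
  ⨅ (T : N.Space →L[ℂ] N.Space) (_ : IsCompOp N φ T), approxNumber T n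

/-- The product of the first `n` approximation numbers of `C_φ` on the space of `N`. -/
def approxProd (N : ExtNorm) (φ : SelfMap) (n : ℕ) : ℝ≥0∞ :=
  ∏ j ∈ Finset.Icc 1 n, compApprox N φ j

/-! ### The Hardy, Bergman and Dirichlet norms -/

/-- Normalized area measure `dx dy / π` on the unit disk. -/
def areaMeasure : Measure ℂ := ENNReal.ofReal (Real.pi⁻¹) • volume.restrict disk

/-- Normalized Lebesgue measure `dt / 2π` on `(0, 2π]`, for integration over circles. -/
def arcMeasure : Measure ℝ :=
  ENNReal.ofReal ((2 * Real.pi)⁻¹) • volume.restrict (Set.Ioc 0 (2 * Real.pi))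

/-- `∫_𝕋 |f(rξ)|² dm(ξ)`. -/
def circleMeanSq (r : ℝ) (f : ℂ → ℂ) : ℝ≥0∞ :=
  ∫⁻ t, ‖f (r * Complex.exp (t * Complex.I))‖ₑ ^ 2 ∂arcMeasure

/-- `sup_{0 < r < 1} ∫_𝕋 |f(rξ)|² dm(ξ)`. -/
def hardySq (f : ℂ → ℂ) : ℝ≥0∞ := ⨆ r ∈ Set.Ioo (0 : ℝ) 1, circleMeanSq r f

/-- `∫_𝔻 |f|² dA`. -/
def areaSq (f : ℂ → ℂ) : ℝ≥0∞ := ∫⁻ z, ‖f z‖ₑ ^ 2 ∂areaMeasure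

lemma lintegral_sq_triangle {α : Type*} [MeasurableSpace α] {μ : Measure α} {f g : α → ℂ}
    (hf : AEMeasurable f μ) (hg : AEMeasurable g μ) :
    (∫⁻ x, ‖f x + g x‖ₑ ^ 2 ∂μ) ^ (1 / 2 : ℝ) ≤
      (∫⁻ x, ‖f x‖ₑ ^ 2 ∂μ) ^ (1 / 2 : ℝ) + (∫⁻ x, ‖g x‖ₑ ^ 2 ∂μ) ^ (1 / 2 : ℝ) := by
  have h := ENNReal.lintegral_Lp_add_le (p := 2) hf.enorm hg.enorm (by norm_num)
  simp only [Pi.add_apply, ENNReal.rpow_two] at h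
  refine le_trans ?_ h
  gcongr
  exact enorm_add_le _ _

lemma lintegral_sq_smul {α : Type*} [MeasurableSpace α] {μ : Measure α} (c : ℂ) (f : α → ℂ) :
    ∫⁻ x, ‖c * f x‖ₑ ^ 2 ∂μ = ‖c‖ₑ ^ 2 * ∫⁻ x, ‖f x‖ₑ ^ 2 ∂μ := by
  simp only [enorm_mul, mul_pow]
  exact lintegral_const_mul' _ _ (by simp)

lemma circle_mem_disk {r : ℝ} (hr : r ∈ Set.Ioo (0 : ℝ) 1) (t : ℝ) :
    (r : ℂ) * Complex.exp (t * Complex.I) ∈ disk := by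
  simp [disk, Complex.norm_exp_ofReal_mul_I, abs_of_pos hr.1, hr.2]

lemma continuous_circle (f : Hol) {r : ℝ} (hr : r ∈ Set.Ioo (0 : ℝ) 1) :
    Continuous fun t : ℝ => (f : ℂ → ℂ) (r * Complex.exp (t * Complex.I)) :=
  f.2.1.continuousOn.comp_continuous (by fun_prop) (circle_mem_disk hr)

lemma hardySq_smul (c : ℂ) (f : Hol) :
    hardySq (c • f : Hol) = ‖c‖ₑ ^ 2 * hardySq f := by
  simp only [hardySq, ENNReal.mul_iSup]
  refine iSup_congr fun r => iSup_congr fun _ => ?_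
  exact lintegral_sq_smul c _

lemma hardySq_triangle (f g : Hol) :
    hardySq (f + g : Hol) ^ (1 / 2 : ℝ) ≤ hardySq f ^ (1 / 2 : ℝ) + hardySq g ^ (1 / 2 : ℝ) := by
  rw [one_div, ENNReal.rpow_inv_le_iff (by norm_num)]
  refine iSup₂_le fun r hr => ?_
  rw [← ENNReal.rpow_inv_le_iff (by norm_num), ← one_div]
  refine (lintegral_sq_triangle (continuous_circle f hr).aemeasurable
    (continuous_circle g hr).aemeasurable).trans ?_
  gcongr
  · exact le_iSup₂ (f := fun r (_ : r ∈ Set.Ioo (0 : ℝ) 1) => circleMeanSq r f) r hr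
  · exact le_iSup₂ (f := fun r (_ : r ∈ Set.Ioo (0 : ℝ) 1) => circleMeanSq r g) r hr

lemma pair_triangle {a b a₁ b₁ a₂ b₂ : ℝ≥0∞}
    (ha : a ^ (1 / 2 : ℝ) ≤ a₁ ^ (1 / 2 : ℝ) + a₂ ^ (1 / 2 : ℝ))
    (hb : b ^ (1 / 2 : ℝ) ≤ b₁ ^ (1 / 2 : ℝ) + b₂ ^ (1 / 2 : ℝ)) :
    (a + b) ^ (1 / 2 : ℝ) ≤ (a₁ + b₁) ^ (1 / 2 : ℝ) + (a₂ + b₂) ^ (1 / 2 : ℝ) := by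
  have key := ENNReal.Lp_add_le (Finset.univ : Finset (Fin 2))
    ![a₁ ^ (1 / 2 : ℝ), b₁ ^ (1 / 2 : ℝ)] ![a₂ ^ (1 / 2 : ℝ), b₂ ^ (1 / 2 : ℝ)]
    (p := 2) (by norm_num)
  have e : ∀ x : ℝ≥0∞, (x ^ (1 / 2 : ℝ)) ^ (2 : ℝ) = x := fun x => by
    rw [← ENNReal.rpow_mul]; norm_num
  simp only [Fin.sum_univ_two, Matrix.cons_val_zero, Matrix.cons_val_one, e] at key
  refine le_trans ?_ key
  rw [← e a, ← e b]
  gcongr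

lemma areaMeasure_ae_zero {f : ℂ → ℂ} (hf : ContinuousOn f disk) (h : areaSq f = 0) :
    ∀ z ∈ disk, f z = 0 := by
  have hpi : ENNReal.ofReal (Real.pi⁻¹) ≠ 0 := by
    simp [Real.pi_pos]
  rw [areaSq, areaMeasure, lintegral_smul_measure, smul_eq_mul, mul_eq_zero] at h
  have h := h.resolve_left hpi
  have hm : AEMeasurable f (volume.restrict disk) :=
    hf.aemeasurable isOpen_disk.measurableSet
  rw [lintegral_eq_zero_iff' (hm.enorm.pow_const 2)] at h
  have h0 : f =ᵐ[volume.restrict disk] fun _ => (0 : ℂ) := by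
    filter_upwards [h] with z hz
    simpa using hz
  exact Measure.eqOn_open_of_ae_eq h0 isOpen_disk hf continuousOn_const

lemma hol_ext {f : Hol} (h : ∀ z ∈ disk, (f : ℂ → ℂ) z = 0) : f = 0 := by
  ext z
  by_cases hz : z ∈ disk
  · exact h z hz
  · exact f.2.2 z hz

lemma hardySq_eq_zero (f : Hol) (h : hardySq f = 0) : f = 0 := by
  have hpi : ENNReal.ofReal ((2 * Real.pi)⁻¹) ≠ 0 := by
    simp [Real.pi_pos]
  have h1 : ∀ z ∈ disk, z ≠ 0 → (f : ℂ → ℂ) z = 0 := by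
    intro z hz hz0
    have hr : ‖z‖ ∈ Set.Ioo (0 : ℝ) 1 := ⟨norm_pos_iff.2 hz0, by simpa [disk] using hz⟩
    have hc := continuous_circle f hr
    have hm : circleMeanSq ‖z‖ f = 0 := by
      have := le_iSup₂ (f := fun r (_ : r ∈ Set.Ioo (0 : ℝ) 1) => circleMeanSq r f) ‖z‖ hr
      exact le_antisymm (this.trans h.le) bot_le
    rw [circleMeanSq, arcMeasure, lintegral_smul_measure, smul_eq_mul, mul_eq_zero] at hm
    have hm := hm.resolve_left hpi
    rw [lintegral_eq_zero_iff (hc.measurable.enorm.pow_const 2)] at hm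
    have h0 : (fun t : ℝ => (f : ℂ → ℂ) (‖z‖ * Complex.exp (t * Complex.I)))
        =ᵐ[volume.restrict (Set.Ioc 0 (2 * Real.pi))] fun _ => (0 : ℂ) := by
      filter_upwards [hm] with t ht
      simpa using ht
    have h2 := Measure.eqOn_Ioc_of_ae_eq volume h0 hc.continuousOn continuousOn_const
    have hmem := toIocMod_mem_Ioc Real.two_pi_pos 0 z.arg
    rw [zero_add] at hmem
    have h3 := h2 hmem
    have hexp : Complex.exp ((toIocMod Real.two_pi_pos 0 z.arg : ℝ) * Complex.I) =
        Complex.exp (z.arg * Complex.I) := by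
      rw [Complex.exp_eq_exp_iff_exists_int]
      refine ⟨-toIocDiv Real.two_pi_pos 0 z.arg, ?_⟩
      rw [toIocMod]
      push_cast
      simp
      ring
    simp only at h3
    rwa [hexp, Complex.norm_mul_exp_arg_mul_I] at h3
  refine hol_ext fun z hz => ?_
  by_cases hz0 : z = 0
  · subst hz0
    have hcont := (f.2.1.differentiableAt (isOpen_disk.mem_nhds hz)).continuousAt
    have hlim : Filter.Tendsto (f : ℂ → ℂ) (nhdsWithin 0 {0}ᶜ) (nhds 0) := by
      refine tendsto_const_nhds.congr' ?_
      filter_upwards [self_mem_nhdsWithin, mem_nhdsWithin_of_mem_nhds (isOpen_disk.mem_nhds hz)]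
        with w hw hw'
      exact (h1 w hw' hw).symm
    exact tendsto_nhds_unique (hcont.tendsto.mono_left nhdsWithin_le_nhds) hlim
  · exact h1 z hz hz0

lemma continuousOn_deriv (f : Hol) : ContinuousOn (deriv (f : ℂ → ℂ)) disk :=
  (f.2.1.deriv isOpen_disk).continuousOn

lemma areaSq_smul (c : ℂ) (f : ℂ → ℂ) : areaSq (fun z => c * f z) = ‖c‖ₑ ^ 2 * areaSq f :=
  lintegral_sq_smul c f

lemma areaSq_triangle {f g : ℂ → ℂ} (hf : ContinuousOn f disk) (hg : ContinuousOn g disk) :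
    areaSq (fun z => f z + g z) ^ (1 / 2 : ℝ) ≤
      areaSq f ^ (1 / 2 : ℝ) + areaSq g ^ (1 / 2 : ℝ) :=
  lintegral_sq_triangle ((hf.aemeasurable isOpen_disk.measurableSet).smul_measure _)
    ((hg.aemeasurable isOpen_disk.measurableSet).smul_measure _)

lemma areaSq_congr {f g : ℂ → ℂ} (h : ∀ z ∈ disk, f z = g z) : areaSq f = areaSq g := by
  unfold areaSq areaMeasure
  rw [lintegral_smul_measure, lintegral_smul_measure]
  congr 1
  exact setLIntegral_congr_fun isOpen_disk.measurableSet fun z hz => by simp [h z hz]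

lemma differentiableAt_hol (f : Hol) {z : ℂ} (hz : z ∈ disk) :
    DifferentiableAt ℂ (f : ℂ → ℂ) z := f.2.1.differentiableAt (isOpen_disk.mem_nhds hz)

/-- `∫_𝔻 |f'|² dA`. -/
def dirichletIntegral (f : ℂ → ℂ) : ℝ≥0∞ := areaSq (deriv f)

lemma dirichletIntegral_smul (c : ℂ) (f : Hol) :
    dirichletIntegral (c • f : Hol) = ‖c‖ₑ ^ 2 * dirichletIntegral f := by
  rw [dirichletIntegral, dirichletIntegral, ← areaSq_smul]
  refine areaSq_congr fun z hz => ?_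
  exact deriv_const_smul c (differentiableAt_hol f hz)

lemma dirichletIntegral_triangle (f g : Hol) :
    dirichletIntegral (f + g : Hol) ^ (1 / 2 : ℝ) ≤
      dirichletIntegral f ^ (1 / 2 : ℝ) + dirichletIntegral g ^ (1 / 2 : ℝ) := by
  refine le_trans (le_of_eq ?_) (areaSq_triangle (continuousOn_deriv f) (continuousOn_deriv g))
  congr 1
  exact areaSq_congr fun z hz => deriv_add (differentiableAt_hol f hz) (differentiableAt_hol g hz)

lemma sq_root (x : ℝ≥0∞) : (x ^ 2) ^ (1 / 2 : ℝ) = x := by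
  rw [← ENNReal.rpow_two, ← ENNReal.rpow_mul]
  norm_num

lemma dirichlet_eq_zero (f : Hol) (h0 : (f : ℂ → ℂ) 0 = 0)
    (h : dirichletIntegral f = 0) : f = 0 := by
  have hd := areaMeasure_ae_zero (continuousOn_deriv f) h
  refine hol_ext fun z hz => ?_
  have hz0 : (0 : ℂ) ∈ disk := by simp [disk]
  rw [isOpen_disk.is_const_of_deriv_eq_zero (convex_ball 0 1).isPreconnected f.2.1 hd hz hz0, h0]

/-- The Hardy space `H²`: `‖f‖² = sup_{0 < r < 1} ∫_𝕋 |f(rξ)|² dm(ξ)`. -/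
def hardy : ExtNorm where
  sq f := hardySq f
  sq_smul := hardySq_smul
  triangle := hardySq_triangle
  eq_zero := hardySq_eq_zero

/-- The Bergman space: `‖f‖² = ∫_𝔻 |f|² dA`. -/
def bergman : ExtNorm where
  sq f := areaSq f
  sq_smul c f := areaSq_smul c f
  triangle f g := areaSq_triangle f.2.1.continuousOn g.2.1.continuousOn
  eq_zero f h := hol_ext (areaMeasure_ae_zero f.2.1.continuousOn h)

/-- The Dirichlet space: `‖f‖² = |f(0)|² + ∫_𝔻 |f'|² dA`. -/
def dirichlet : ExtNorm where
  sq f := ‖(f : ℂ → ℂ) 0‖ₑ ^ 2 + dirichletIntegral f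
  sq_smul c f := by
    rw [dirichletIntegral_smul, mul_add]
    simp [mul_pow]
  triangle f g := by
    refine pair_triangle ?_ (dirichletIntegral_triangle f g)
    simp only [sq_root]
    exact enorm_add_le _ _
  eq_zero f h := by
    rw [add_eq_zero] at h
    exact dirichlet_eq_zero f (by simpa using h.1) h.2

/-- The Dirichlet space with the equivalent norm `‖f‖² = ‖f‖²_{H²} + ∫_𝔻 |f'|² dA`. -/
def dirichletAlt : ExtNorm where
  sq f := hardySq f + dirichletIntegral f
  sq_smul c f := by
    rw [dirichletIntegral_smul, hardySq_smul, mul_add]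
  triangle f g := pair_triangle (hardySq_triangle f g) (dirichletIntegral_triangle f g)
  eq_zero f h := by
    rw [add_eq_zero] at h
    exact hardySq_eq_zero f h.1

end CompDisk

end

/-!
A symbol `φ` that fixes the origin has `φ ^ k` divisible by `z ^ k`, so that the matrix of `C_φ`
in the monomials is lower triangular. The norms of the four spaces are weighted `ℓ²` norms
`∑ w k * |c k|²` of the Taylor coefficients, with weights `1 / (k + 1)` (Bergman), `1` (Hardy),
`max 1 k` and `k + 1` (the two Dirichlet norms). With respect to the normalized monomials, passing
from one of the spaces to a larger one therefore replaces the triangular matrix `A` by `D⁻¹ A D`,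
where `D` is diagonal with nondecreasing positive entries.

The product of the first `n` approximation numbers of an operator `T` on a Hilbert space equals the
supremum of `|det ⟪v i, T (u j)⟫|` over orthonormal systems `u`, `v` of `n` vectors
(`detSup_le_prod_approxNumber`, `prod_approxNumber_le_detSup`). For finitely supported systems, the
determinant formed with `D⁻ᶻ A Dᶻ` is an entire function of `z`. It is bounded on the right
half-plane, because only factors `(d k / d m) ^ z` with `k ≤ m` occur, and on the imaginary axis
`Dᶻ` is unitary, so that there it is bounded by the supremum for `A`. The Phragmén–Lindelöf
principle at `z = 1` compares the two operators (`detSup_le_of_triangular`).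

For a general symbol with `φ 0 = a` one writes `φ = τ ∘ ψ`, where `τ` is the automorphism of the
disk with `τ 0 = a` and `ψ 0 = 0`. The operators `C_τ` and `C_τ⁻¹` are bounded on all the spaces,
which gives the constant `K`. Boundedness on the Hardy space rests on the orthogonality of the
Szegő kernel at `b` to the functions vanishing at `b` (`hardySq_kernel_add_le`), applied to a zero
`b` of the symbol. On the Bergman space it follows by integration over circles for `ψ`, and by a
change of variables for `τ`.

An operator on a Hilbert space is compact if and only if its approximation numbers tend to `0`, and
approximation numbers are dominated by their geometric means. So compactness passes from one space
to the other by the convergence of arithmetic means, and membership in the Schatten classes by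
Carleman's inequality (`sum_le_of_prod_le`).
-/

noncomputable section

namespace CompDisk

/-! ### Determinants of compressions -/

section Determinants

variable {H : Type*} [NormedAddCommGroup H] [InnerProductSpace ℂ H]

/-- The matrix `(⟪v i, T (u j)⟫)` of the compression of `T` to two finite systems of vectors. -/
def compression {ι : Type*} (T : H →L[ℂ] H) (u v : ι → H) : Matrix ι ι ℂ :=
  Matrix.of fun i j => inner ℂ (v i) (T (u j))

/-- Hadamard's inequality. -/
lemma norm_det_le_prod_norm_col {n : ℕ} (M : Matrix (Fin n) (Fin n) ℂ) :
    ‖M.det‖ ≤ ∏ j, ‖(WithLp.toLp 2 fun i => M i j : EuclideanSpace ℂ (Fin n))‖ := by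
  set f : Fin n → EuclideanSpace ℂ (Fin n) := fun j => WithLp.toLp 2 fun i => M i j with hf
  have hcard : Module.finrank ℂ (EuclideanSpace ℂ (Fin n)) = Fintype.card (Fin n) := by simp
  set b := InnerProductSpace.gramSchmidtOrthonormalBasis hcard f
  set e := EuclideanSpace.basisFun (Fin n) ℂ
  have h1 : b.toBasis.det f = ∏ i, inner ℂ (b i) (f i) :=
    InnerProductSpace.gramSchmidtOrthonormalBasis_det hcard f
  have h2 : e.toBasis.det f = e.toBasis.det b * b.toBasis.det f := by
    rw [Module.Basis.det_apply, Module.Basis.det_apply, Module.Basis.det_apply, ← Matrix.det_mul]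
    congr 1
    have := Module.Basis.toMatrix_mul_toMatrix e.toBasis b.toBasis f
    rw [← this]
    simp
  have h3 : e.toBasis.det f = M.det := by
    rw [Module.Basis.det_apply]
    congr 1
  have h4 : ‖e.toBasis.det b‖ = 1 := e.det_to_matrix_orthonormalBasis b
  rw [← h3, h2, norm_mul, h4, one_mul, h1, norm_prod]
  refine Finset.prod_le_prod (fun _ _ => norm_nonneg _) fun i _ => ?_
  refine (norm_inner_le_norm _ _).trans ?_
  simp [b.orthonormal.1 i, hf]

/-- In an `n`-dimensional space there is an orthonormal basis whose `j`-th vector is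
annihilated by the `j`-th member of a given sequence of operators of ranks `≤ 0, 1, …, n - 1`. -/
lemma exists_orthonormal_annihilated (n : ℕ) (U : Submodule ℂ H) [FiniteDimensional ℂ U]
    (hU : Module.finrank ℂ U = n) (R : Fin n → H →L[ℂ] H)
    (hR : ∀ j, LinearMap.rank (R j : H →ₗ[ℂ] H) ≤ (j : ℕ)) :
    ∃ w : Fin n → H, Orthonormal ℂ w ∧ (∀ j, w j ∈ U) ∧ ∀ j, R j (w j) = 0 := by
  induction n generalizing U with
  | zero => exact ⟨Fin.elim0, ⟨fun i => i.elim0, fun i => i.elim0⟩, fun i => i.elim0,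
      fun i => i.elim0⟩
  | succ n ih =>
    obtain ⟨x, hxU, hx0, hRx⟩ : ∃ x ∈ U, x ≠ 0 ∧ R (Fin.last n) x = 0 := by
      by_contra! hcon
      have hinj : Function.Injective ((R (Fin.last n) : H →ₗ[ℂ] H).domRestrict U) := by
        rw [← LinearMap.ker_eq_bot, LinearMap.ker_eq_bot']
        intro y hy
        by_contra hy0
        exact hcon y y.2 (by simpa using hy0) (by simpa using hy)
      have h1 := LinearMap.rank_le_of_injective
        (((R (Fin.last n) : H →ₗ[ℂ] H).domRestrict U).rangeRestrict)
        (fun a b hab => hinj (congrArg Subtype.val hab))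
      have h2 : Module.rank ℂ (LinearMap.range ((R (Fin.last n) : H →ₗ[ℂ] H).domRestrict U)) ≤
          LinearMap.rank (R (Fin.last n) : H →ₗ[ℂ] H) := by
        refine Submodule.rank_mono ?_
        rintro _ ⟨y, rfl⟩
        exact ⟨y, rfl⟩
      have h3 := (h1.trans h2).trans (hR (Fin.last n))
      rw [← Module.finrank_eq_rank, hU] at h3
      simp only [Fin.val_last, Nat.cast_le] at h3
      omega
    set y : H := ((‖x‖ : ℂ)⁻¹) • x with hy
    have hyU : y ∈ U := U.smul_mem _ hxU
    have hynorm : ‖y‖ = 1 := by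
      rw [hy, norm_smul, norm_inv, Complex.norm_real, norm_norm]
      exact inv_mul_cancel₀ (norm_ne_zero_iff.2 hx0)
    have hRy : R (Fin.last n) y = 0 := by rw [hy, map_smul, hRx, smul_zero]
    have hle : ℂ ∙ y ≤ U := by rwa [Submodule.span_singleton_le_iff_mem]
    have hfin := Submodule.finrank_add_inf_finrank_orthogonal hle
    rw [hU, finrank_span_singleton (by rintro h; simp [h] at hynorm)] at hfin
    have : FiniteDimensional ℂ ((ℂ ∙ y)ᗮ ⊓ U : Submodule ℂ H) :=
      Submodule.finiteDimensional_inf_right _ _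
    obtain ⟨w, hw, hwU, hwR⟩ := ih ((ℂ ∙ y)ᗮ ⊓ U) (by omega) (fun j => R j.castSucc)
      (fun j => hR j.castSucc)
    have hyw : ∀ j, inner ℂ y (w j) = 0 := fun j =>
      (Submodule.mem_orthogonal_singleton_iff_inner_right).1 (hwU j).1
    refine ⟨Fin.snoc w y, ⟨fun i => ?_, fun i j hij => ?_⟩, fun i => ?_, fun i => ?_⟩
    · refine Fin.lastCases ?_ (fun i => ?_) i
      · simpa using hynorm
      · simpa using hw.1 i
    · induction i using Fin.lastCases with
      | last =>
        induction j using Fin.lastCases with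
        | last => exact absurd rfl hij
        | cast j => simpa using hyw j
      | cast i =>
        induction j using Fin.lastCases with
        | last => simpa using inner_eq_zero_symm.1 (hyw i)
        | cast j => simpa using hw.2 (fun h => hij (by rw [h]))
    · refine Fin.lastCases ?_ (fun i => ?_) i
      · simpa using hyU
      · simpa using (hwU i).2
    · refine Fin.lastCases ?_ (fun i => ?_) i
      · simpa using hRy
      · simpa using hwR i

/-- Bessel's inequality and Hadamard's inequality. -/
lemma norm_det_compression_le_prod_norm {n : ℕ} (T : H →L[ℂ] H) {w v : Fin n → H}
    (hv : Orthonormal ℂ v) : ‖(compression T w v).det‖ ≤ ∏ j, ‖T (w j)‖ := by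
  refine (norm_det_le_prod_norm_col _).trans
    (Finset.prod_le_prod (fun _ _ => norm_nonneg _) fun j _ => ?_)
  refine le_of_sq_le_sq ?_ (norm_nonneg _)
  rw [EuclideanSpace.norm_sq_eq]
  exact hv.sum_inner_products_le (x := T (w j)) (s := Finset.univ)

/-- Since determinants of compressions do not change in modulus when `u` is replaced by another
orthonormal basis of its span, the vectors can be chosen in the kernels of the `R j`. -/
lemma norm_det_compression_le_prod_norm_sub {n : ℕ} (T : H →L[ℂ] H) {u v : Fin n → H}
    (hu : Orthonormal ℂ u) (hv : Orthonormal ℂ v) (R : Fin n → H →L[ℂ] H)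
    (hR : ∀ j, LinearMap.rank (R j : H →ₗ[ℂ] H) ≤ (j : ℕ)) :
    ‖(compression T u v).det‖ ≤ ∏ j, ‖T - R j‖ := by
  have : FiniteDimensional ℂ (Submodule.span ℂ (Set.range u)) :=
    FiniteDimensional.span_of_finite ℂ (Set.finite_range u)
  have hfr : Module.finrank ℂ (Submodule.span ℂ (Set.range u)) = n := by
    rw [finrank_span_eq_card hu.linearIndependent, Fintype.card_fin]
  obtain ⟨w, hw, hwU, hwR⟩ := exists_orthonormal_annihilated n _ hfr R hR
  set w' : Fin n → Submodule.span ℂ (Set.range u) := fun j => ⟨w j, hwU j⟩ with hw'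
  have hwo : Orthonormal ℂ w' :=
    ⟨fun i => hw.1 i, fun i j hij => hw.2 hij⟩
  have hli := hwo.linearIndependent
  set b : OrthonormalBasis (Fin n) ℂ (Submodule.span ℂ (Set.range u)) :=
    OrthonormalBasis.mk hwo (hli.span_eq_top_of_card_eq_finrank' (by simp [hfr])).ge with hb
  have hbw : ∀ i, (b i : H) = w i := fun i => by simp [hb, hw']
  have hexp : ∀ j, u j = ∑ k, inner ℂ (w k) (u j) • w k := fun j => by
    have := congrArg Subtype.val
      (b.sum_repr' ⟨u j, Submodule.subset_span ⟨j, rfl⟩⟩)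
    simpa [hbw, Submodule.coe_inner] using this.symm
  set Q : Matrix (Fin n) (Fin n) ℂ := Matrix.of fun k j => inner ℂ (w k) (u j) with hQ
  have hmul : compression T u v = compression T w v * Q := by
    ext i j
    rw [Matrix.mul_apply, compression, Matrix.of_apply]
    conv_lhs => rw [hexp j]
    rw [map_sum, inner_sum]
    refine Finset.sum_congr rfl fun k _ => ?_
    rw [map_smul, inner_smul_right, compression, Matrix.of_apply, hQ, Matrix.of_apply, mul_comm]
  have hQ1 : Q.conjTranspose * Q = 1 := by
    ext i j
    have h1 : inner ℂ (u i) (u j) = if i = j then (1 : ℂ) else 0 :=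
      orthonormal_iff_ite.1 hu i j
    rw [Matrix.one_apply, ← h1]
    conv_rhs => rw [hexp j, inner_sum]
    rw [Matrix.mul_apply]
    refine Finset.sum_congr rfl fun k _ => ?_
    rw [inner_smul_right, Matrix.conjTranspose_apply, hQ, Matrix.of_apply, Matrix.of_apply,
      ← starRingEnd_apply, inner_conj_symm, mul_comm]
  have hdetQ : ‖Q.det‖ = 1 := by
    have h := congrArg Matrix.det hQ1
    rw [Matrix.det_mul, Matrix.det_conjTranspose, Matrix.det_one] at h
    have h2 := congrArg norm h
    rw [norm_mul, norm_star, norm_one] at h2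
    nlinarith [norm_nonneg Q.det]
  rw [hmul, Matrix.det_mul, norm_mul, hdetQ, mul_one]
  refine (norm_det_compression_le_prod_norm T hv).trans
    (Finset.prod_le_prod (fun _ _ => norm_nonneg _) fun j _ => ?_)
  have : T (w j) = (T - R j) (w j) := by simp [hwR j]
  rw [this]
  refine ((T - R j).le_opNorm _).trans ?_
  rw [hw.1 j, mul_one]

end Determinants

/-! ### Approximation numbers -/

section ApproxNumber

variable {E : Type} [NormedAddCommGroup E] [NormedSpace ℂ E]

lemma approxNumber_le_enorm (T : E →L[ℂ] E) {n : ℕ} (hn : 1 ≤ n) : approxNumber T n ≤ ‖T‖ₑ := by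
  refine (iInf₂_le (0 : E →L[ℂ] E) ?_).trans (by simp)
  rw [ContinuousLinearMap.toLinearMap_zero, LinearMap.rank_zero]
  exact_mod_cast hn

lemma approxNumber_ne_top (T : E →L[ℂ] E) {n : ℕ} (hn : 1 ≤ n) : approxNumber T n ≠ ∞ :=
  ne_top_of_le_ne_top enorm_ne_top (approxNumber_le_enorm T hn)

lemma approxNumber_anti (T : E →L[ℂ] E) {m n : ℕ} (h : m ≤ n) :
    approxNumber T n ≤ approxNumber T m := by
  refine le_iInf₂ fun R hR => iInf₂_le R (hR.trans_le (by exact_mod_cast h))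

lemma approxNumber_comp_le {F : Type} [NormedAddCommGroup F] [NormedSpace ℂ F]
    (A : E →L[ℂ] F) (T : E →L[ℂ] E) (B : F →L[ℂ] E) {n : ℕ} (hn : 1 ≤ n) :
    approxNumber (A ∘L T ∘L B) n ≤ ‖A‖ₑ * ‖B‖ₑ * approxNumber T n := by
  have hAB : ‖A‖ₑ * ‖B‖ₑ ≠ ∞ := ENNReal.mul_ne_top enorm_ne_top enorm_ne_top
  have hne : Nonempty {R : E →L[ℂ] E // LinearMap.rank (R : E →ₗ[ℂ] E) < n} := by
    refine ⟨⟨0, ?_⟩⟩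
    rw [ContinuousLinearMap.toLinearMap_zero, LinearMap.rank_zero]
    exact_mod_cast hn
  conv_rhs => rw [approxNumber, iInf_subtype', ENNReal.mul_iInf' (by simp [hAB]) fun _ => hne]
  refine le_iInf fun ⟨R, hR⟩ => ?_
  refine (iInf₂_le (A ∘L R ∘L B) ?_).trans ?_
  · refine lt_of_le_of_lt ?_ hR
    refine (LinearMap.lift_rank_comp_le_right ((R ∘L B : F →L[ℂ] E) : F →ₗ[ℂ] E)
      (A : E →ₗ[ℂ] F)).trans ?_ |> Cardinal.lift_le.1
    exact Cardinal.lift_le.2 (LinearMap.rank_comp_le_left (B : F →ₗ[ℂ] E) (R : E →ₗ[ℂ] E))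
  · have h : A ∘L T ∘L B - A ∘L R ∘L B = A ∘L (T - R) ∘L B := by
      ext x; simp
    rw [h]
    simp only [← ofReal_norm]
    rw [← ENNReal.ofReal_mul (norm_nonneg _), ← ENNReal.ofReal_mul (by positivity)]
    refine ENNReal.ofReal_le_ofReal ?_
    refine (ContinuousLinearMap.opNorm_comp_le _ _).trans ?_
    refine (mul_le_mul_of_nonneg_left (ContinuousLinearMap.opNorm_comp_le _ _)
      (norm_nonneg _)).trans (le_of_eq (by ring))

end ApproxNumber

/-! ### Products of approximation numbers as suprema of determinants -/

section DetSup

variable {H : Type} [NormedAddCommGroup H] [InnerProductSpace ℂ H]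

/-- The supremum of `|det ⟪v i, T (u j)⟫|` over all orthonormal systems `u`, `v` of `n` vectors
in the subspace `F`; for dense `F` it is the norm of the `n`-th exterior power of `T`. -/
def detSup (T : H →L[ℂ] H) (F : Submodule ℂ H) (n : ℕ) : ℝ≥0∞ :=
  ⨆ (u : Fin n → H) (v : Fin n → H) (_ : Orthonormal ℂ u) (_ : Orthonormal ℂ v)
    (_ : ∀ i, u i ∈ F) (_ : ∀ i, v i ∈ F), ‖(compression T u v).det‖ₑ

lemma enorm_det_le_detSup {T : H →L[ℂ] H} {F : Submodule ℂ H} {n : ℕ} {u v : Fin n → H}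
    (hu : Orthonormal ℂ u) (hv : Orthonormal ℂ v) (huF : ∀ i, u i ∈ F) (hvF : ∀ i, v i ∈ F) :
    ‖(compression T u v).det‖ₑ ≤ detSup T F n := by
  refine le_iSup₂_of_le u v <| le_iSup₂_of_le hu hv <| le_iSup₂_of_le huF hvF le_rfl

lemma detSup_le {T : H →L[ℂ] H} {F : Submodule ℂ H} {n : ℕ} {C : ℝ≥0∞}
    (h : ∀ u v : Fin n → H, Orthonormal ℂ u → Orthonormal ℂ v → (∀ i, u i ∈ F) →
      (∀ i, v i ∈ F) → ‖(compression T u v).det‖ₑ ≤ C) : detSup T F n ≤ C :=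
  iSup₂_le fun u v => iSup₂_le fun hu hv => iSup₂_le fun huF hvF => h u v hu hv huF hvF

/-- Half of the formula for products of approximation numbers: nearly optimal operators of rank
`< j`, for `1 ≤ j ≤ n`, are inserted in `norm_det_compression_le_prod_norm_sub`. -/
theorem detSup_le_prod_approxNumber (T : H →L[ℂ] H) (F : Submodule ℂ H) (n : ℕ) :
    detSup T F n ≤ ∏ j ∈ Finset.Icc 1 n, approxNumber T j := by
  refine detSup_le fun u v hu hv _ _ => ?_
  have hprod : ∏ j ∈ Finset.Icc 1 n, approxNumber T j =
      ∏ j : Fin n, approxNumber T (j + 1) := by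
    rw [Fin.prod_univ_eq_prod_range (fun j => approxNumber T (j + 1)), Finset.range_eq_Ico,
      Finset.prod_Ico_add' (fun j => approxNumber T j) 0 n 1]
    rfl
  set a : Fin n → ℝ := fun j => (approxNumber T (j + 1)).toReal with ha
  have haT : ∀ j : Fin n, approxNumber T (j + 1) ≠ ∞ := fun j => approxNumber_ne_top T (by omega)
  have key : ∀ ε : ℝ, 0 < ε → ‖(compression T u v).det‖ ≤ ∏ j, (a j + ε) := by
    intro ε hε
    have hex : ∀ j : Fin n, ∃ R : H →L[ℂ] H,
        LinearMap.rank (R : H →ₗ[ℂ] H) < ((j + 1 : ℕ) : Cardinal) ∧ ‖T - R‖ ≤ a j + ε := by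
      intro j
      have hlt : approxNumber T (j + 1) < ENNReal.ofReal (a j + ε) := by
        rw [← ENNReal.ofReal_toReal (haT j)]
        exact (ENNReal.ofReal_lt_ofReal_iff (by positivity)).2 (by simp [ha, hε])
      rw [approxNumber, iInf_lt_iff] at hlt
      obtain ⟨R, hR⟩ := hlt
      rw [iInf_lt_iff] at hR
      obtain ⟨hR1, hR2⟩ := hR
      refine ⟨R, hR1, ?_⟩
      rw [← ofReal_norm] at hR2
      exact (ENNReal.ofReal_le_ofReal_iff (by positivity)).1 hR2.le
    choose R hR1 hR2 using hex
    refine (norm_det_compression_le_prod_norm_sub T hu hv R fun j => ?_).trans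
      (Finset.prod_le_prod (fun _ _ => norm_nonneg _) fun j _ => hR2 j)
    have := hR1 j
    obtain ⟨m, hm⟩ := Cardinal.lt_aleph0.1 (this.trans Cardinal.natCast_lt_aleph0)
    rw [hm] at this ⊢
    exact_mod_cast Nat.lt_succ_iff.1 (by exact_mod_cast this)
  have hlim : Filter.Tendsto (fun ε : ℝ => ∏ j, (a j + ε)) (nhdsWithin 0 (Set.Ioi 0))
      (nhds (∏ j, (a j + 0))) :=
    (Continuous.tendsto (by fun_prop) 0).mono_left nhdsWithin_le_nhds
  have hle := ge_of_tendsto hlim (by filter_upwards [self_mem_nhdsWithin] with ε hε using key ε hε)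
  rw [hprod, ← ofReal_norm]
  refine (ENNReal.ofReal_le_ofReal hle).trans (le_of_eq ?_)
  rw [ENNReal.ofReal_prod_of_nonneg (by intros; simp [ha])]
  refine Finset.prod_congr rfl fun j _ => ?_
  rw [add_zero, ha, ENNReal.ofReal_toReal (haT j)]

/-- The Schur complement of the compression of `T` to two orthonormal systems of `n` vectors,
subtracted from `T`, is an operator of rank at most `n`. -/
lemma approxNumber_mul_enorm_det_le (T : H →L[ℂ] H) {F : Submodule ℂ H} (hF : Dense (F : Set H))
    {n : ℕ} {u v : Fin n → H} (hu : Orthonormal ℂ u) (hv : Orthonormal ℂ v)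
    (huF : ∀ i, u i ∈ F) (hvF : ∀ i, v i ∈ F) :
    approxNumber T (n + 1) * ‖(compression T u v).det‖ₑ ≤ detSup T F (n + 1) := by
  set M := compression T u v with hM
  by_cases hdet : M.det = 0
  · simp [hdet]
  rcases eq_or_ne (detSup T F (n + 1)) ∞ with htop | htop
  · simp [htop]
  have hunit : IsUnit M.det := isUnit_iff_ne_zero.2 hdet
  set C : ℝ := (detSup T F (n + 1)).toReal with hC
  -- the operator `T U M⁻¹ V* T`
  set R : H →L[ℂ] H := ∑ i, ∑ j, M⁻¹ i j •
    ((innerSL ℂ (v j)).comp T).smulRight (T (u i)) with hR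
  have hRapp : ∀ x, R x = ∑ i, (∑ j, M⁻¹ i j * inner ℂ (v j) (T x)) • T (u i) := by
    intro x
    simp [hR, Finset.sum_smul, smul_smul]
  have hrank : LinearMap.rank (R : H →ₗ[ℂ] H) < ((n + 1 : ℕ) : Cardinal) := by
    have hle : LinearMap.range (R : H →ₗ[ℂ] H) ≤ Submodule.span ℂ (Set.range fun i => T (u i)) := by
      rintro _ ⟨x, rfl⟩
      change R x ∈ _
      rw [hRapp]
      exact Submodule.sum_mem _ fun i _ =>
        Submodule.smul_mem _ _ (Submodule.subset_span ⟨i, rfl⟩)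
    have h1 : LinearMap.rank (R : H →ₗ[ℂ] H) ≤ (n : Cardinal) := by
      refine (Submodule.rank_mono hle).trans ((rank_span_le _).trans ?_)
      refine Cardinal.mk_range_le.trans (by simp)
    refine h1.trans_lt ?_
    exact_mod_cast Nat.lt_succ_self n
  have hMij : ∀ i j, M i j = inner ℂ (v i) (T (u j)) := fun i j => rfl
  -- `T - R` annihilates the `u j` and its range is orthogonal to the `v i`
  have hSu : ∀ k, (T - R) (u k) = 0 := by
    intro k
    have : ∀ i, ∑ j, M⁻¹ i j * inner ℂ (v j) (T (u k)) = if i = k then 1 else 0 := fun i => by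
      have := congrFun (congrFun (Matrix.nonsing_inv_mul M hunit) i) k
      rwa [Matrix.mul_apply, Matrix.one_apply] at this
    simp [hRapp, this]
  have hSv : ∀ k x, inner ℂ (v k) ((T - R) x) = 0 := by
    intro k x
    have h1 : ∀ j, ∑ i, M k i * M⁻¹ i j = if k = j then 1 else 0 := fun j => by
      have := congrFun (congrFun (Matrix.mul_nonsing_inv M hunit) k) j
      rwa [Matrix.mul_apply, Matrix.one_apply] at this
    have h2 : inner ℂ (v k) (R x) = ∑ j, (∑ i, M k i * M⁻¹ i j) * inner ℂ (v j) (T x) := by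
      rw [hRapp, inner_sum]
      simp only [inner_smul_right, Finset.sum_mul, ← hMij]
      rw [Finset.sum_comm]
      refine Finset.sum_congr rfl fun i _ => Finset.sum_congr rfl fun j _ => by ring
    rw [sub_apply, inner_sub_right, h2]
    simp [h1]
  -- the bordered determinant
  have hunitvec : ∀ x y : H, x ∈ F → y ∈ F → ‖x‖ = 1 → ‖y‖ = 1 → (∀ i, inner ℂ (u i) x = 0) →
      (∀ i, inner ℂ (v i) y = 0) → ‖M.det‖ * ‖inner ℂ y ((T - R) x)‖ ≤ C := by
    intro x y hx hy hx1 hy1 hux hvy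
    have hsnoc : ∀ (w : Fin n → H) (z : H), Orthonormal ℂ w → ‖z‖ = 1 → (∀ i, inner ℂ (w i) z = 0) →
        Orthonormal ℂ (Fin.snoc w z : Fin (n + 1) → H) := by
      intro w z hw hz hwz
      refine ⟨fun i => ?_, fun i j hij => ?_⟩
      · refine Fin.lastCases ?_ (fun i => ?_) i
        · simpa using hz
        · simpa using hw.1 i
      · induction i using Fin.lastCases with
        | last =>
          induction j using Fin.lastCases with
          | last => exact absurd rfl hij
          | cast j => simpa using inner_eq_zero_symm.1 (hwz j)
        | cast i =>
          induction j using Fin.lastCases with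
          | last => simpa using hwz i
          | cast j => simpa using hw.2 (fun h => hij (by rw [h]))
    have hsnocF : ∀ (w : Fin n → H) (z : H), (∀ i, w i ∈ F) → z ∈ F →
        ∀ i, (Fin.snoc w z : Fin (n + 1) → H) i ∈ F := by
      intro w z hw hz i
      refine Fin.lastCases ?_ (fun i => ?_) i
      · simpa using hz
      · simpa using hw i
    have hle := enorm_det_le_detSup (T := T) (hsnoc u x hu hx1 hux) (hsnoc v y hv hy1 hvy)
      (hsnocF u x huF hx) (hsnocF v y hvF hy)
    have hblock : (compression T (Fin.snoc u x : Fin (n + 1) → H) (Fin.snoc v y)).submatrix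
        finSumFinEquiv finSumFinEquiv = Matrix.fromBlocks M
          (Matrix.of fun i (_ : Fin 1) => inner ℂ (v i) (T x))
          (Matrix.of fun (_ : Fin 1) j => inner ℂ y (T (u j)))
          (Matrix.of fun (_ : Fin 1) (_ : Fin 1) => inner ℂ y (T x)) := by
      have hc : ∀ i : Fin n, Fin.castAdd 1 i = i.castSucc := fun _ => rfl
      have hl : ∀ i : Fin 1, Fin.natAdd n i = Fin.last n := fun i => by
        rw [Subsingleton.elim i 0]; rfl
      ext (i | i) (j | j) <;> simp [compression, hM, hc, hl]
    have : Invertible M := Matrix.invertibleOfIsUnitDet M hunit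
    have hdet' : (compression T (Fin.snoc u x : Fin (n + 1) → H) (Fin.snoc v y)).det =
        M.det * inner ℂ y ((T - R) x) := by
      rw [← Matrix.det_submatrix_equiv_self finSumFinEquiv, hblock, Matrix.det_fromBlocks₁₁,
        Matrix.det_fin_one, Matrix.invOf_eq_nonsing_inv]
      congr 1
      rw [sub_apply, inner_sub_right, hRapp, inner_sum]
      simp only [inner_smul_right, Matrix.sub_apply, Matrix.of_apply, Matrix.mul_apply,
        Finset.sum_mul]
      congr 1
      rw [Finset.sum_comm]
      refine Finset.sum_congr rfl fun i _ => Finset.sum_congr rfl fun j _ => by ring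
    rw [hdet', ← ofReal_norm, ENNReal.ofReal_le_iff_le_toReal htop, norm_mul] at hle
    exact hle
  have hperp : ∀ x y : H, x ∈ F → y ∈ F → (∀ i, inner ℂ (u i) x = 0) →
      (∀ i, inner ℂ (v i) y = 0) → ‖M.det‖ * ‖inner ℂ y ((T - R) x)‖ ≤ C * ‖x‖ * ‖y‖ := by
    intro x y hx hy hux hvy
    rcases eq_or_ne x 0 with rfl | hx0
    · simp
    rcases eq_or_ne y 0 with rfl | hy0
    · simp
    have hx' : 0 < ‖x‖ := norm_pos_iff.2 hx0
    have hy' : 0 < ‖y‖ := norm_pos_iff.2 hy0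
    have h := hunitvec ((‖x‖ : ℂ)⁻¹ • x) ((‖y‖ : ℂ)⁻¹ • y) (F.smul_mem _ hx) (F.smul_mem _ hy)
      (by simp [norm_smul, hx'.ne']) (by simp [norm_smul, hy'.ne'])
      (fun i => by rw [inner_smul_right, hux, mul_zero])
      (fun i => by rw [inner_smul_right, hvy, mul_zero])
    rw [map_smul, inner_smul_right, inner_smul_left] at h
    simp only [norm_mul, map_inv₀, norm_inv, Complex.norm_real, Complex.conj_ofReal, norm_norm] at h
    rw [mul_assoc, ← div_le_iff₀ (by positivity)]
    refine le_trans (le_of_eq ?_) h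
    field_simp
  have hall : ∀ x y : H, x ∈ F → y ∈ F →
      ‖M.det‖ * ‖inner ℂ y ((T - R) x)‖ ≤ C * ‖x‖ * ‖y‖ := by
    intro x y hx hy
    -- remove from `x` and `y` their components along the two systems
    have hcomp : ∀ (w : Fin n → H) (z : H), Orthonormal ℂ w → (∀ i, w i ∈ F) → z ∈ F →
        ∃ z' ∈ F, (∀ i, inner ℂ (w i) z' = 0) ∧ ‖z'‖ ≤ ‖z‖ ∧
          z = z' + ∑ i, inner ℂ (w i) z • w i := by
      intro w z hw hwF hz
      have horth : ∀ i, inner ℂ (w i) (z - ∑ i, inner ℂ (w i) z • w i) = 0 := fun i => by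
        rw [inner_sub_right, hw.inner_right_fintype, sub_self]
      refine ⟨z - ∑ i, inner ℂ (w i) z • w i,
        F.sub_mem hz (F.sum_mem fun i _ => F.smul_mem _ (hwF i)), horth, ?_, by abel⟩
      have hpy : inner ℂ (∑ i, inner ℂ (w i) z • w i) (z - ∑ i, inner ℂ (w i) z • w i) = 0 := by
        rw [sum_inner]
        exact Finset.sum_eq_zero fun i _ => by rw [inner_smul_left, horth, mul_zero]
      have h := norm_add_sq_eq_norm_sq_add_norm_sq_of_inner_eq_zero _ _ hpy
      rw [add_sub_cancel] at h
      nlinarith [norm_nonneg z, norm_nonneg (z - ∑ i, inner ℂ (w i) z • w i),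
        norm_nonneg (∑ i, inner ℂ (w i) z • w i)]
    obtain ⟨x', hx'F, hx'u, hx'n, hxx'⟩ := hcomp u x hu huF hx
    obtain ⟨y', hy'F, hy'v, hy'n, hyy'⟩ := hcomp v y hv hvF hy
    have h1 : (T - R) x = (T - R) x' := by
      conv_lhs => rw [hxx']
      rw [map_add, map_sum]
      simp only [map_smul, hSu, smul_zero, Finset.sum_const_zero, add_zero]
    have h2 : inner ℂ y ((T - R) x') = inner ℂ y' ((T - R) x') := by
      conv_lhs => rw [hyy']
      rw [inner_add_left, sum_inner]
      simp only [inner_smul_left, hSv, mul_zero, Finset.sum_const_zero, add_zero]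
    rw [h1, h2]
    refine (hperp x' y' hx'F hy'F hx'u hy'v).trans ?_
    have : 0 ≤ C := ENNReal.toReal_nonneg
    gcongr
  have hCpos : 0 ≤ C := ENNReal.toReal_nonneg
  have hdpos : 0 < ‖M.det‖ := norm_pos_iff.2 hdet
  have hall' : ∀ x y : H, ‖M.det‖ * ‖inner ℂ y ((T - R) x)‖ ≤ C * ‖x‖ * ‖y‖ := by
    intro x y
    refine hF.denseRange_val.induction_on₂
      (p := fun x y => ‖M.det‖ * ‖inner ℂ y ((T - R) x)‖ ≤ C * ‖x‖ * ‖y‖) ?_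
      (fun x y => hall x y x.2 y.2) x y
    exact isClosed_le (by fun_prop) (by fun_prop)
  have hnorm : ‖T - R‖ ≤ C / ‖M.det‖ := by
    refine ContinuousLinearMap.opNorm_le_bound _ (by positivity) fun x => ?_
    rw [div_mul_eq_mul_div, le_div_iff₀ hdpos]
    rcases eq_or_ne ((T - R) x) 0 with h0 | h0
    · rw [h0, norm_zero, zero_mul]; positivity
    · have h := hall' x ((T - R) x)
      rw [inner_self_eq_norm_sq_to_K] at h
      simp only [norm_pow, Complex.coe_algebraMap, Complex.norm_real, norm_norm] at h
      have h0' : 0 < ‖(T - R) x‖ := norm_pos_iff.2 h0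
      nlinarith
  calc approxNumber T (n + 1) * ‖M.det‖ₑ ≤ ‖T - R‖ₑ * ‖M.det‖ₑ := by
        gcongr
        exact iInf₂_le R hrank
    _ = ENNReal.ofReal (‖T - R‖ * ‖M.det‖) := by
        rw [ENNReal.ofReal_mul (norm_nonneg _), ofReal_norm, ofReal_norm]
    _ ≤ ENNReal.ofReal C := ENNReal.ofReal_le_ofReal ((le_div_iff₀ hdpos).1 hnorm)
    _ = detSup T F (n + 1) := ENNReal.ofReal_toReal htop

/-- The other half of the formula for products of approximation numbers, by induction on `n`. No
compactness of `T` is needed. -/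
theorem prod_approxNumber_le_detSup (T : H →L[ℂ] H) {F : Submodule ℂ H}
    (hF : Dense (F : Set H)) (n : ℕ) :
    ∏ j ∈ Finset.Icc 1 n, approxNumber T j ≤ detSup T F n := by
  induction n with
  | zero =>
    have h : Orthonormal ℂ (Fin.elim0 : Fin 0 → H) := ⟨fun i => i.elim0, fun i => i.elim0⟩
    refine le_trans ?_ (enorm_det_le_detSup h h (fun i => i.elim0) fun i => i.elim0)
    simp
  | succ n ih =>
    rw [Finset.prod_Icc_succ_top (by omega), mul_comm]
    refine (mul_le_mul_right ih _).trans ?_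
    rw [detSup]
    simp only [ENNReal.mul_iSup]
    exact iSup₂_le fun u v => iSup₂_le fun hu hv => iSup₂_le fun huF hvF =>
      approxNumber_mul_enorm_det_le T hF hu hv huF hvF

end DetSup

/-! ### Triangular matrices and diagonal conjugation -/

section Triangular

/-- The Hilbert space `ℓ²(ℕ)`. -/
abbrev SeqSpace : Type := lp (fun _ : ℕ => ℂ) 2

/-- The standard unit vectors of `ℓ²(ℕ)`. -/
def unitVec (k : ℕ) : SeqSpace := lp.single 2 k (1 : ℂ)

lemma unitVec_apply (k m : ℕ) : unitVec k m = if m = k then 1 else 0 := by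
  simp [unitVec, lp.single_apply, Pi.single_apply]

/-- The finitely supported sequences. -/
def finSupport : Submodule ℂ SeqSpace where
  carrier := {x | ∃ N, ∀ k, N ≤ k → x k = 0}
  add_mem' := by
    rintro x y ⟨M, hM⟩ ⟨N, hN⟩
    refine ⟨max M N, fun k hk => ?_⟩
    rw [lp.coeFn_add, Pi.add_apply, hM k (le_trans (le_max_left _ _) hk),
      hN k (le_trans (le_max_right _ _) hk), add_zero]
  zero_mem' := ⟨0, fun k _ => rfl⟩
  smul_mem' := by
    rintro c x ⟨N, hN⟩
    exact ⟨N, fun k hk => by rw [lp.coeFn_smul, Pi.smul_apply, hN k hk, smul_zero]⟩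

lemma unitVec_mem_finSupport (k : ℕ) : unitVec k ∈ finSupport :=
  ⟨k + 1, fun m hm => by rw [unitVec_apply, if_neg (by omega)]⟩

lemma hasSum_unitVec (x : SeqSpace) : HasSum (fun k => x k • unitVec k) x := by
  have h : (fun k => x k • unitVec k) = fun k => lp.single 2 k (x k) := by
    funext k
    rw [unitVec, ← lp.single_smul, smul_eq_mul, mul_one]
  rw [h]
  exact lp.hasSum_single (by norm_num) x

lemma dense_finSupport : Dense (finSupport : Set SeqSpace) := by
  intro x
  refine mem_closure_of_tendsto (hasSum_unitVec x) (Filter.Eventually.of_forall fun s => ?_)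
  exact finSupport.sum_mem fun k _ => finSupport.smul_mem _ (unitVec_mem_finSupport k)

lemma eq_sum_unitVec {x : SeqSpace} {N : ℕ} (hx : ∀ k, N ≤ k → x k = 0) :
    x = ∑ k ∈ Finset.range N, x k • unitVec k := by
  refine (hasSum_unitVec x).unique (hasSum_sum_of_ne_finset_zero fun k hk => ?_)
  rw [hx k (by simpa using hk), zero_smul]

lemma inner_map_eq_sum (T : SeqSpace →L[ℂ] SeqSpace) {u v : SeqSpace} {N : ℕ}
    (hu : ∀ k, N ≤ k → u k = 0) (hv : ∀ k, N ≤ k → v k = 0) :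
    inner ℂ v (T u) = ∑ m ∈ Finset.range N, ∑ k ∈ Finset.range N,
      starRingEnd ℂ (v m) * u k * (T (unitVec k)) m := by
  have h1 : ∀ y : SeqSpace, inner ℂ v y =
      ∑ m ∈ Finset.range N, starRingEnd ℂ (v m) * y m := fun y => by
    rw [lp.inner_eq_tsum, tsum_eq_sum (s := Finset.range N)]
    · exact Finset.sum_congr rfl fun m _ => by rw [RCLike.inner_apply, mul_comm]
    · intro m hm
      rw [hv m (by simpa using hm), inner_zero_left]
  rw [h1]
  refine Finset.sum_congr rfl fun m _ => ?_
  conv_lhs => rw [eq_sum_unitVec hu]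
  rw [map_sum, lp.coeFn_sum, Finset.sum_apply, Finset.mul_sum]
  refine Finset.sum_congr rfl fun k _ => ?_
  rw [map_smul, lp.coeFn_smul, Pi.smul_apply, smul_eq_mul, mul_assoc]

/-- Multiplication of the `k`-th coordinate by `exp (i θ k)`. -/
def rotate (θ : ℕ → ℝ) (x : SeqSpace) : SeqSpace :=
  ⟨fun k => Complex.exp (θ k * Complex.I) * x k, by
    refine (lp.memℓp x).mono' fun k => ?_
    rw [norm_mul, Complex.norm_exp_ofReal_mul_I, one_mul]⟩

lemma rotate_apply (θ : ℕ → ℝ) (x : SeqSpace) (k : ℕ) :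
    rotate θ x k = Complex.exp (θ k * Complex.I) * x k := rfl

lemma inner_rotate (θ : ℕ → ℝ) (x y : SeqSpace) :
    inner ℂ (rotate θ x) (rotate θ y) = inner ℂ x y := by
  rw [lp.inner_eq_tsum, lp.inner_eq_tsum]
  refine tsum_congr fun k => ?_
  rw [rotate_apply, rotate_apply, RCLike.inner_apply, RCLike.inner_apply, map_mul,
    ← Complex.exp_conj]
  have : Complex.exp (θ k * Complex.I) * Complex.exp (starRingEnd ℂ (θ k * Complex.I)) = 1 := by
    rw [← Complex.exp_add]
    simp
  linear_combination (y k * starRingEnd ℂ (x k)) * this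

lemma orthonormal_rotate {ι : Type*} (θ : ℕ → ℝ) {u : ι → SeqSpace} (hu : Orthonormal ℂ u) :
    Orthonormal ℂ fun i => rotate θ (u i) := by
  classical
  rw [orthonormal_iff_ite] at hu ⊢
  intro i j
  rw [inner_rotate, hu]

lemma rotate_mem_finSupport (θ : ℕ → ℝ) {x : SeqSpace} (hx : x ∈ finSupport) :
    rotate θ x ∈ finSupport := by
  obtain ⟨N, hN⟩ := hx
  exact ⟨N, fun k hk => by rw [rotate_apply, hN k hk, mul_zero]⟩

/-- If `T` has a lower triangular matrix `A` and `D` is a diagonal matrix with positive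
nondecreasing entries, then `z ↦ D⁻ᶻ A Dᶻ` is bounded on the right half-plane and unitarily
equivalent to `A` on the imaginary axis, so that the determinants of the compressions of
`D⁻¹ A D` are controlled by those of `A`. -/
theorem detSup_le_of_triangular {T T' : SeqSpace →L[ℂ] SeqSpace} {d : ℕ → ℝ}
    (hd : ∀ k, 0 < d k) (hmono : Monotone d) (hT : ∀ m k, m < k → (T (unitVec k)) m = 0)
    (hT' : ∀ m k, (T' (unitVec k)) m = (T (unitVec k)) m * (d k / d m : ℝ)) (n : ℕ) :
    detSup T' finSupport n ≤ detSup T finSupport n := by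
  rcases eq_or_ne (detSup T finSupport n) ∞ with htop | htop
  · simp [htop]
  refine detSup_le fun u v hu hv huF hvF => ?_
  obtain ⟨N, huN, hvN⟩ : ∃ N, (∀ i k, N ≤ k → u i k = 0) ∧ ∀ i k, N ≤ k → v i k = 0 := by
    choose a ha using huF
    choose b hb using hvF
    refine ⟨∑ i, a i + ∑ i, b i, fun i k hk => ha i k ?_, fun i k hk => hb i k ?_⟩
    · have := Finset.single_le_sum (f := a) (fun _ _ => Nat.zero_le _) (Finset.mem_univ i)
      omega
    · have := Finset.single_le_sum (f := b) (fun _ _ => Nat.zero_le _) (Finset.mem_univ i)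
      omega
  -- `G z` is the matrix of the compression of `D⁻ᶻ A Dᶻ` to `u` and `v`
  set L : ℕ → ℝ := fun k => Real.log (d k) with hL
  have hLmono : Monotone L := fun a b hab => Real.log_le_log (hd a) (hmono hab)
  set A : ℕ → ℕ → ℂ := fun m k => (T (unitVec k)) m with hA
  set G : ℂ → Matrix (Fin n) (Fin n) ℂ := fun z => Matrix.of fun i j =>
    ∑ m ∈ Finset.range N, ∑ k ∈ Finset.range N,
      starRingEnd ℂ (v i m) * u j k * (A m k * Complex.exp (-(z * (L m - L k : ℝ)))) with hG
  have hGapp : ∀ z i j, G z i j = ∑ m ∈ Finset.range N, ∑ k ∈ Finset.range N,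
      starRingEnd ℂ (v i m) * u j k * (A m k * Complex.exp (-(z * (L m - L k : ℝ)))) :=
    fun _ _ _ => rfl
  have hGdiff : Differentiable ℂ fun z => (G z).det := by
    simp only [Matrix.det_apply, hG, Matrix.of_apply]
    fun_prop
  have hG1 : G 1 = compression T' u v := by
    ext i j
    rw [hGapp, compression, Matrix.of_apply, inner_map_eq_sum T' (huN j) (hvN i)]
    refine Finset.sum_congr rfl fun m _ => Finset.sum_congr rfl fun k _ => ?_
    rw [hT']
    congr 2
    rw [one_mul, ← Complex.ofReal_neg, ← Complex.ofReal_exp, neg_sub, Real.exp_sub,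
      Real.exp_log (hd k), Real.exp_log (hd m)]
  have hGim : ∀ y : ℝ, ‖(G (y * Complex.I)).det‖ ≤ (detSup T finSupport n).toReal := by
    intro y
    have h := enorm_det_le_detSup (T := T) (orthonormal_rotate (fun k => y * L k) hu)
      (orthonormal_rotate (fun k => y * L k) hv) (fun i => rotate_mem_finSupport _ (huF i))
      (fun i => rotate_mem_finSupport _ (hvF i))
    rw [← ofReal_norm, ENNReal.ofReal_le_iff_le_toReal htop] at h
    refine le_trans (le_of_eq ?_) h
    congr 2
    ext i j
    rw [hGapp, compression, Matrix.of_apply, inner_map_eq_sum (N := N) T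
      (fun k hk => by rw [rotate_apply, huN j k hk, mul_zero])
      (fun k hk => by rw [rotate_apply, hvN i k hk, mul_zero])]
    refine Finset.sum_congr rfl fun m _ => Finset.sum_congr rfl fun k _ => ?_
    have : Complex.exp (-(y * Complex.I * (L m - L k : ℝ))) =
        starRingEnd ℂ (Complex.exp ((y * L m : ℝ) * Complex.I)) *
          Complex.exp ((y * L k : ℝ) * Complex.I) := by
      rw [← Complex.exp_conj, ← Complex.exp_add]
      congr 1
      simp
      ring
    rw [this, rotate_apply, rotate_apply, map_mul]
    ring
  obtain ⟨B, hB⟩ : ∃ B : ℝ, ∀ z : ℂ, 0 ≤ z.re → ‖(G z).det‖ ≤ B := by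
    let q : Fin n → Fin n → ℝ := fun i j => ∑ m ∈ Finset.range N, ∑ k ∈ Finset.range N,
      ‖starRingEnd ℂ (v i m) * u j k * A m k‖
    have hq : ∀ i j, 0 ≤ q i j := fun i j =>
      Finset.sum_nonneg fun m _ => Finset.sum_nonneg fun k _ => norm_nonneg _
    let b : ℝ := ∑ i, ∑ j, q i j
    refine ⟨(Fintype.card (Fin n)).factorial • b ^ Fintype.card (Fin n), fun z hz => ?_⟩
    refine Matrix.det_le (abv := IsAbsoluteValue.toAbsoluteValue (norm : ℂ → ℝ)) fun i j => ?_
    have h1 : ‖G z i j‖ ≤ q i j := by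
      rw [hGapp]
      refine (norm_sum_le _ _).trans (Finset.sum_le_sum fun m _ => ?_)
      refine (norm_sum_le _ _).trans (Finset.sum_le_sum fun k _ => ?_)
      rw [← mul_assoc, norm_mul _ (Complex.exp _)]
      rcases lt_or_ge m k with hmk | hmk
      · simp [hA, hT m k hmk]
      · refine mul_le_of_le_one_right (norm_nonneg _) ?_
        rw [Complex.norm_exp, Real.exp_le_one_iff, Complex.neg_re, Complex.re_mul_ofReal]
        have := hLmono hmk
        have := mul_nonneg hz (sub_nonneg.2 this)
        linarith
    exact (h1.trans (Finset.single_le_sum (f := q i) (fun j _ => hq i j) (Finset.mem_univ j))).trans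
      (Finset.single_le_sum (f := fun i => ∑ j, q i j)
        (fun i _ => Finset.sum_nonneg fun j _ => hq i j) (Finset.mem_univ i))
  have hPL := PhragmenLindelof.right_half_plane_of_bounded_on_real (f := fun z => (G z).det)
    (z := 1) hGdiff.diffContOnCl
    ⟨1, by norm_num, 0, by
      refine Asymptotics.IsBigO.of_bound B ?_
      refine Filter.eventually_inf_principal.2 (Filter.Eventually.of_forall fun z hz => ?_)
      simpa using hB z (le_of_lt hz)⟩
    ⟨B, by
      rw [Filter.eventually_map]
      filter_upwards [Filter.eventually_ge_atTop 0] with x hx using hB x (by simpa using hx)⟩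
    hGim (by simp)
  rw [← hG1, ← ofReal_norm, ENNReal.ofReal_le_iff_le_toReal htop]
  exact hPL

/-- Conjugation of a lower triangular matrix by a diagonal matrix with nondecreasing positive entries
decreases the products of approximation numbers. -/
theorem prod_approxNumber_le_of_triangular {T T' : SeqSpace →L[ℂ] SeqSpace} {d : ℕ → ℝ}
    (hd : ∀ k, 0 < d k) (hmono : Monotone d) (hT : ∀ m k, m < k → (T (unitVec k)) m = 0)
    (hT' : ∀ m k, (T' (unitVec k)) m = (T (unitVec k)) m * (d k / d m : ℝ)) (n : ℕ) :
    ∏ j ∈ Finset.Icc 1 n, approxNumber T' j ≤ ∏ j ∈ Finset.Icc 1 n, approxNumber T j :=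
  (prod_approxNumber_le_detSup T' dense_finSupport n).trans <|
    (detSup_le_of_triangular hd hmono hT hT' n).trans (detSup_le_prod_approxNumber T _ n)

end Triangular

/-! ### Taylor coefficients and the Hardy, Bergman and Dirichlet norms -/

section Coefficients

lemma hasSum_of_eq {f g : ℕ → ℂ} {a : ℂ} (h : ∀ k, f k = g k) (hf : HasSum f a) : HasSum g a :=
  funext h ▸ hf

/-- `f` is the sum of the power series with coefficients `c` on the disk. -/
def HasCoeffs (f : ℂ → ℂ) (c : ℕ → ℂ) : Prop :=
  ∀ z ∈ disk, HasSum (fun k => c k * z ^ k) (f z)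

lemma mem_disk_iff {z : ℂ} : z ∈ disk ↔ ‖z‖ < 1 := by simp [disk]

lemma zero_mem_disk : (0 : ℂ) ∈ disk := by simp [disk]

/-- The Taylor coefficients at the origin. -/
def coeff (f : ℂ → ℂ) (k : ℕ) : ℂ := (k.factorial : ℂ)⁻¹ * iteratedDeriv k f 0

lemma hasCoeffs_coeff {f : ℂ → ℂ} (hf : DifferentiableOn ℂ f disk) : HasCoeffs f (coeff f) := by
  intro z hz
  have h := Complex.hasSum_taylorSeries_on_ball (c := 0) (r := 1) (f := f)
    (by simpa [disk] using hf) (by simpa [disk] using hz)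
  refine hasSum_of_eq (fun k => ?_) h
  simp only [coeff, smul_eq_mul, sub_zero]
  ring

lemma HasCoeffs.hasFPowerSeriesAt {f : ℂ → ℂ} {c : ℕ → ℂ} (h : HasCoeffs f c) :
    HasFPowerSeriesAt f (FormalMultilinearSeries.ofScalars ℂ c) 0 := by
  rw [hasFPowerSeriesAt_iff]
  filter_upwards [isOpen_disk.mem_nhds zero_mem_disk] with z hz
  rw [zero_add]
  refine hasSum_of_eq (fun k => ?_) (h z hz)
  rw [FormalMultilinearSeries.coeff_ofScalars, smul_eq_mul, mul_comm]

lemma HasCoeffs.unique {f : ℂ → ℂ} {c d : ℕ → ℂ} (hc : HasCoeffs f c) (hd : HasCoeffs f d) :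
    c = d :=
  FormalMultilinearSeries.ofScalars_series_injective ℂ ℂ
    (hc.hasFPowerSeriesAt.eq_formalMultilinearSeries hd.hasFPowerSeriesAt)

lemma HasCoeffs.summable {f : ℂ → ℂ} {c : ℕ → ℂ} (h : HasCoeffs f c) {r : ℝ} (hr0 : 0 ≤ r)
    (hr : r < 1) : Summable fun k => ‖c k‖ * r ^ k := by
  have := (h r (by simpa [disk, abs_of_nonneg hr0] using hr)).summable.norm
  simpa [abs_of_nonneg hr0] using this

lemma HasCoeffs.eval_zero {f : ℂ → ℂ} {c : ℕ → ℂ} (h : HasCoeffs f c) : f 0 = c 0 := by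
  have h1 := h 0 zero_mem_disk
  have h2 := hasSum_ite_eq 0 (c 0)
  refine h1.unique ?_
  refine hasSum_of_eq (fun k => ?_) h2
  by_cases hk : k = 0 <;> simp [hk]

/-- A power series whose terms are bounded by those of a convergent series on every smaller disk
defines an analytic function on the disk. -/
lemma exists_hasCoeffs {c : ℕ → ℂ} (h : ∀ r : ℝ, 0 ≤ r → r < 1 → Summable fun k => ‖c k‖ * r ^ k) :
    ∃ f : Hol, HasCoeffs (f : ℂ → ℂ) c := by
  have hsum : ∀ z ∈ disk, HasSum (fun k => c k * z ^ k) (∑' k, c k * z ^ k) := fun z hz => by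
    refine Summable.hasSum (Summable.of_norm ?_)
    simpa using h ‖z‖ (norm_nonneg _) (mem_disk_iff.1 hz)
  have hdiff : DifferentiableOn ℂ (fun z => ∑' k, c k * z ^ k) disk := by
    intro z hz
    obtain ⟨r, hzr, hr⟩ := exists_between (mem_disk_iff.1 hz)
    have hr0 : 0 ≤ r := (norm_nonneg z).trans hzr.le
    have := Complex.differentiableOn_tsum_of_summable_norm (F := fun k z => c k * z ^ k)
      (U := Metric.ball 0 r) (h r hr0 hr)
      (fun k => ((differentiable_id.pow k).const_mul _).differentiableOn) Metric.isOpen_ball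
      (fun k w hw => by
        rw [norm_mul, norm_pow]
        have : ‖w‖ ≤ r := by simpa using (Metric.mem_ball.1 hw).le
        gcongr)
    exact (this.differentiableAt (Metric.isOpen_ball.mem_nhds (by simpa using hzr))
      ).differentiableWithinAt
  refine ⟨⟨disk.indicator fun z => ∑' k, c k * z ^ k, hdiff.congr fun z hz =>
    Set.indicator_of_mem hz _, fun z hz => Set.indicator_of_notMem hz _⟩, fun z hz => ?_⟩
  simpa [Set.indicator_of_mem hz] using hsum z hz

lemma coeff_deriv (f : ℂ → ℂ) (k : ℕ) : coeff (deriv f) k = (k + 1) * coeff f (k + 1) := by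
  rw [coeff, coeff, iteratedDeriv_succ', Nat.factorial_succ]
  push_cast
  have h1 : (k.factorial : ℂ) ≠ 0 := by exact_mod_cast k.factorial_ne_zero
  have h2 : (k : ℂ) + 1 ≠ 0 := by exact_mod_cast k.succ_ne_zero
  field_simp

lemma integral_exp_int_mul (n : ℤ) (α : ℝ) :
    ∫ t in α..α + 2 * Real.pi, Complex.exp (n * t * Complex.I) =
      if n = 0 then (2 * Real.pi : ℂ) else 0 := by
  split_ifs with h
  · simp [h]
  · have hc : (n * Complex.I : ℂ) ≠ 0 := by simp [h]
    have h1 : ∀ t : ℝ, Complex.exp (n * t * Complex.I) = Complex.exp (n * Complex.I * t) := by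
      intro t; congr 1; ring
    simp_rw [h1]
    rw [integral_exp_mul_complex hc]
    have h2 : Complex.exp (n * Complex.I * (α + 2 * Real.pi : ℝ)) =
        Complex.exp (n * Complex.I * α) := by
      rw [Complex.exp_eq_exp_iff_exists_int]
      exact ⟨n, by push_cast; ring⟩
    rw [h2, sub_self, zero_div]

/-- Parseval's identity over one period, for an absolutely convergent Fourier series with frequencies `≥ 0`. -/
lemma integral_norm_sq_of_hasSum {a : ℕ → ℂ} {g : ℝ → ℂ} (ha : Summable fun k => ‖a k‖)
    (hg : ∀ t : ℝ, HasSum (fun k => a k * Complex.exp (k * t * Complex.I)) (g t))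
    (hgc : Continuous g) (α : ℝ) :
    HasSum (fun k => 2 * Real.pi * ‖a k‖ ^ 2) (∫ t in α..α + 2 * Real.pi, ‖g t‖ ^ 2) := by
  have hcoef : ∀ l : ℕ, ∫ t in α..α + 2 * Real.pi, g t * Complex.exp (-(l * t * Complex.I)) =
      2 * Real.pi * a l := by
    intro l
    have h := intervalIntegral.hasSum_integral_of_dominated_convergence (μ := volume)
      (a := α) (b := α + 2 * Real.pi)
      (F := fun (k : ℕ) (t : ℝ) => a k * Complex.exp (k * t * Complex.I) *
        Complex.exp (-(l * t * Complex.I)))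
      (f := fun t => g t * Complex.exp (-(l * t * Complex.I)))
      (fun k _ => ‖a k‖) (fun k => (by fun_prop : Continuous _).aestronglyMeasurable)
      (fun k => Filter.Eventually.of_forall fun t _ => by
        rw [norm_mul, norm_mul, Complex.norm_exp, Complex.norm_exp]
        simp)
      (Filter.Eventually.of_forall fun t _ => ha)
      (by simp)
      (Filter.Eventually.of_forall fun t _ => (hg t).mul_right _)
    refine h.unique ?_
    have h1 : ∀ k : ℕ, ∫ t in α..α + 2 * Real.pi, a k * Complex.exp (k * t * Complex.I) *
        Complex.exp (-(l * t * Complex.I)) = if k = l then 2 * Real.pi * a l else 0 := by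
      intro k
      have h2 : ∀ t : ℝ, a k * Complex.exp (k * t * Complex.I) *
          Complex.exp (-(l * t * Complex.I)) =
          a k * Complex.exp (((k - l : ℤ) : ℂ) * t * Complex.I) := by
        intro t
        rw [mul_assoc, ← Complex.exp_add]
        congr 2
        push_cast
        ring
      simp_rw [h2]
      rw [intervalIntegral.integral_const_mul, integral_exp_int_mul]
      by_cases hkl : k = l
      · subst hkl; simp; ring
      · rw [if_neg (by omega), if_neg hkl, mul_zero]
    simp_rw [h1]
    exact hasSum_ite_eq l _
  have h := intervalIntegral.hasSum_integral_of_dominated_convergence (μ := volume)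
      (a := α) (b := α + 2 * Real.pi)
      (F := fun (l : ℕ) (t : ℝ) => starRingEnd ℂ (a l) * (g t * Complex.exp (-(l * t * Complex.I))))
      (f := fun t => ((‖g t‖ ^ 2 : ℝ) : ℂ))
      (fun k t => ‖a k‖ * ‖g t‖) (fun k => (by fun_prop : Continuous _).aestronglyMeasurable)
      (fun k => Filter.Eventually.of_forall fun t _ => by
        rw [norm_mul, norm_mul, Complex.norm_exp]
        simp)
      (Filter.Eventually.of_forall fun t _ => ha.mul_right _)
      (by
        simp_rw [tsum_mul_right]
        exact (by fun_prop : Continuous _).intervalIntegrable _ _)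
      (Filter.Eventually.of_forall fun t _ => by
        have h1 := (Complex.hasSum_conj'.2 (hg t)).mul_left (g t)
        rw [Complex.mul_conj'] at h1
        rw [Complex.ofReal_pow]
        refine hasSum_of_eq (fun l => ?_) h1
        rw [map_mul, ← Complex.exp_conj]
        simp only [map_mul, Complex.conj_I, Complex.conj_ofReal, map_natCast, mul_neg]
        ring)
  simp_rw [intervalIntegral.integral_const_mul, hcoef] at h
  rw [intervalIntegral.integral_ofReal] at h
  rw [← Complex.hasSum_ofReal]
  refine hasSum_of_eq (fun l => ?_) h
  push_cast
  rw [← Complex.conj_mul']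
  ring

lemma HasCoeffs.lintegral_circle {f : ℂ → ℂ} {c : ℕ → ℂ} (h : HasCoeffs f c)
    (hf : ContinuousOn f disk) {r : ℝ}
    (hr : r ∈ Set.Ioo (0 : ℝ) 1) (α : ℝ) :
    ∫⁻ t in Set.Ioc α (α + 2 * Real.pi), ‖f (r * Complex.exp (t * Complex.I))‖ₑ ^ 2 =
      ENNReal.ofReal (2 * Real.pi) * ∑' k, ENNReal.ofReal (r ^ (2 * k)) * ‖c k‖ₑ ^ 2 := by
  set g : ℝ → ℂ := fun t => f (r * Complex.exp (t * Complex.I)) with hg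
  have hgc : Continuous g := hf.comp_continuous (by fun_prop) (circle_mem_disk hr)
  have hs := integral_norm_sq_of_hasSum (a := fun k => c k * r ^ k) (g := g)
    (by simpa [abs_of_pos hr.1] using h.summable hr.1.le hr.2)
    (fun t => by
      refine hasSum_of_eq (fun k => ?_) (h _ (circle_mem_disk hr t))
      rw [mul_pow, ← Complex.exp_nat_mul]
      ring_nf) hgc α
  have h1 : ∀ t, ‖g t‖ₑ ^ 2 = ENNReal.ofReal (‖g t‖ ^ 2) := fun t => by
    rw [ENNReal.ofReal_pow (norm_nonneg _), ofReal_norm]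
  change ∫⁻ t in _, ‖g t‖ₑ ^ 2 = _
  simp_rw [h1]
  rw [← ofReal_integral_eq_lintegral_ofReal, ← intervalIntegral.integral_of_le
    (by linarith [Real.pi_pos]), ← hs.tsum_eq, ENNReal.ofReal_tsum_of_nonneg
    (fun k => by positivity) hs.summable, ← ENNReal.tsum_mul_left]
  · refine tsum_congr fun k => ?_
    rw [ENNReal.ofReal_mul (by positivity)]
    congr 1
    rw [norm_mul, norm_pow, Complex.norm_real, Real.norm_of_nonneg hr.1.le, mul_pow,
      ENNReal.ofReal_mul (by positivity), ENNReal.ofReal_pow (norm_nonneg _), ofReal_norm,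
      ← pow_mul, mul_comm k 2, mul_comm]
  · exact (by fun_prop : Continuous fun t => ‖g t‖ ^ 2).integrableOn_Ioc
  · exact Filter.Eventually.of_forall fun t => by positivity

lemma circleMeanSq_eq {f : ℂ → ℂ} {c : ℕ → ℂ} (h : HasCoeffs f c)
    (hf : ContinuousOn f disk) {r : ℝ} (hr : r ∈ Set.Ioo (0 : ℝ) 1) :
    circleMeanSq r f = ∑' k, ENNReal.ofReal (r ^ (2 * k)) * ‖c k‖ₑ ^ 2 := by
  rw [circleMeanSq, arcMeasure, lintegral_smul_measure]
  have := h.lintegral_circle hf hr 0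
  rw [zero_add] at this
  rw [this, smul_eq_mul, ← mul_assoc, ← ENNReal.ofReal_mul (by positivity),
    inv_mul_cancel₀ (by positivity), ENNReal.ofReal_one, one_mul]

lemma hardySq_eq {f : ℂ → ℂ} {c : ℕ → ℂ} (h : HasCoeffs f c) (hf : ContinuousOn f disk) :
    hardySq f = ∑' k, ‖c k‖ₑ ^ 2 := by
  refine le_antisymm ?_ ?_
  · refine iSup₂_le fun r hr => ?_
    rw [circleMeanSq_eq h hf hr]
    refine ENNReal.tsum_le_tsum fun k => mul_le_of_le_one_left' ?_
    rw [ENNReal.ofReal_le_one]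
    exact pow_le_one₀ hr.1.le hr.2.le
  · rw [ENNReal.tsum_eq_iSup_sum]
    refine iSup_le fun s => ?_
    have hlim : Filter.Tendsto (fun r : ℝ => ∑ k ∈ s, ENNReal.ofReal (r ^ (2 * k)) * ‖c k‖ₑ ^ 2)
        (nhdsWithin 1 (Set.Iio 1)) (nhds (∑ k ∈ s, ‖c k‖ₑ ^ 2)) := by
      refine tendsto_finsetSum _ fun k _ => ?_
      have h1 : Filter.Tendsto (fun r : ℝ => ENNReal.ofReal (r ^ (2 * k)))
          (nhdsWithin 1 (Set.Iio 1)) (nhds 1) := by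
        have := ((ENNReal.continuous_ofReal.comp (continuous_pow (2 * k))).tendsto (1 : ℝ)).mono_left
          (nhdsWithin_le_nhds (s := Set.Iio 1))
        simpa [Function.comp_def] using this
      have := ENNReal.Tendsto.mul_const (b := ‖c k‖ₑ ^ 2) h1 (Or.inl one_ne_zero)
      rwa [one_mul] at this
    refine le_of_tendsto hlim ?_
    filter_upwards [Ioo_mem_nhdsLT (zero_lt_one' ℝ)] with r hr
    refine le_trans ?_ (le_iSup₂ (f := fun r (_ : r ∈ Set.Ioo (0 : ℝ) 1) => circleMeanSq r f) r hr)
    rw [circleMeanSq_eq h hf hr]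
    exact ENNReal.sum_le_tsum s

/-- The area integral in polar coordinates, as an average of circle means. -/
lemma areaSq_eq_lintegral_circleMeanSq {f : ℂ → ℂ} {c : ℕ → ℂ} (h : HasCoeffs f c)
    (hf : ContinuousOn f disk) :
    areaSq f = ∫⁻ r in Set.Ioo (0 : ℝ) 1, ENNReal.ofReal (2 * r) * circleMeanSq r f := by
  have hm : Measurable (disk.indicator fun z => ‖f z‖ₑ ^ 2) := by
    classical
    rw [← Set.piecewise_eq_indicator]
    exact ContinuousOn.measurable_piecewise ((ENNReal.continuous_pow 2).comp_continuousOn hf.enorm)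
      continuous_zero.continuousOn isOpen_disk.measurableSet
  have hpi := Real.pi_pos
  have hslice : ∀ r ∈ Set.Ioi (0 : ℝ), ∫⁻ t in Set.Ioo (-Real.pi) Real.pi,
      ENNReal.ofReal r * disk.indicator (fun z => ‖f z‖ₑ ^ 2)
        (Complex.polarCoord.symm (r, t)) =
      (Set.Iio (1 : ℝ)).indicator (fun r => ENNReal.ofReal Real.pi *
        (ENNReal.ofReal (2 * r) * circleMeanSq r f)) r := by
    intro r hr0
    have hr0' : 0 < r := hr0
    have hpolar : ∀ t : ℝ, Complex.polarCoord.symm (r, t) = r * Complex.exp (t * Complex.I) := by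
      intro t
      rw [Complex.polarCoord_symm_apply, Complex.exp_mul_I, Complex.ofReal_cos, Complex.ofReal_sin]
    simp_rw [hpolar]
    by_cases hr : r < 1
    · have hr' : r ∈ Set.Ioo (0 : ℝ) 1 := ⟨hr0, hr⟩
      simp_rw [Set.indicator_of_mem (circle_mem_disk hr' _)]
      rw [Set.indicator_of_mem (show r ∈ Set.Iio (1 : ℝ) from hr),
        lintegral_const_mul' _ _ ENNReal.ofReal_ne_top, setLIntegral_congr Ioo_ae_eq_Ioc]
      have h1 := h.lintegral_circle hf hr' (-Real.pi)
      rw [show -Real.pi + 2 * Real.pi = Real.pi by ring] at h1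
      rw [h1, circleMeanSq_eq h hf hr', ← mul_assoc, ← mul_assoc, ← ENNReal.ofReal_mul hr0'.le,
        ← ENNReal.ofReal_mul hpi.le]
      ring_nf
    · have h0 : ∀ t : ℝ, (r : ℂ) * Complex.exp (t * Complex.I) ∉ disk := fun t => by
        rw [mem_disk_iff, norm_mul, Complex.norm_exp_ofReal_mul_I, Complex.norm_real,
          Real.norm_of_nonneg hr0'.le, mul_one]
        exact hr
      simp_rw [Set.indicator_of_notMem (h0 _)]
      rw [Set.indicator_of_notMem (show r ∉ Set.Iio (1 : ℝ) from hr)]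
      simp
  rw [areaSq, areaMeasure, lintegral_smul_measure, ← lintegral_indicator isOpen_disk.measurableSet,
    ← Complex.lintegral_comp_polarCoord_symm, polarCoord_target, Measure.volume_eq_prod,
    ← Measure.prod_restrict, lintegral_prod]
  · simp only [smul_eq_mul]
    rw [setLIntegral_congr_fun measurableSet_Ioi hslice, lintegral_indicator measurableSet_Iio,
      Measure.restrict_restrict measurableSet_Iio, Set.inter_comm, Set.Ioi_inter_Iio,
      lintegral_const_mul' _ _ ENNReal.ofReal_ne_top, ← mul_assoc,
      ← ENNReal.ofReal_mul (by positivity), inv_mul_cancel₀ hpi.ne', ENNReal.ofReal_one, one_mul]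
  · simp only [Complex.polarCoord_symm_apply, smul_eq_mul]
    exact ((by fun_prop : Measurable fun p : ℝ × ℝ => ENNReal.ofReal p.1).mul
      (hm.comp (by fun_prop))).aemeasurable

lemma areaSq_eq {f : ℂ → ℂ} {c : ℕ → ℂ} (h : HasCoeffs f c) (hf : ContinuousOn f disk) :
    areaSq f = ∑' k : ℕ, ENNReal.ofReal (1 / (k + 1)) * ‖c k‖ₑ ^ 2 := by
  rw [areaSq_eq_lintegral_circleMeanSq h hf]
  have h1 : ∀ r ∈ Set.Ioo (0 : ℝ) 1, ENNReal.ofReal (2 * r) * circleMeanSq r f =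
      ∑' k, ENNReal.ofReal (2 * r ^ (2 * k + 1)) * ‖c k‖ₑ ^ 2 := fun r hr => by
    rw [circleMeanSq_eq h hf hr, ← ENNReal.tsum_mul_left]
    refine tsum_congr fun k => ?_
    rw [← mul_assoc, ← ENNReal.ofReal_mul (by linarith [hr.1])]
    congr 2
    ring
  rw [setLIntegral_congr_fun measurableSet_Ioo h1, lintegral_tsum fun k =>
    (by fun_prop : Measurable _).aemeasurable]
  refine tsum_congr fun k => ?_
  rw [lintegral_mul_const _ (by fun_prop)]
  congr 1
  rw [setLIntegral_congr Ioo_ae_eq_Ioc, ← ofReal_integral_eq_lintegral_ofReal,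
    ← intervalIntegral.integral_of_le zero_le_one, intervalIntegral.integral_const_mul,
    integral_pow]
  · congr 1
    push_cast
    field_simp
    simp
    ring
  · exact (by fun_prop : Continuous fun r : ℝ => 2 * r ^ (2 * k + 1)).integrableOn_Ioc
  · filter_upwards [self_mem_ae_restrict measurableSet_Ioc] with r hr
    have := hr.1.le
    positivity

lemma dirichletIntegral_eq {f : ℂ → ℂ} {c : ℕ → ℂ} (h : HasCoeffs f c)
    (hf : DifferentiableOn ℂ f disk) :
    dirichletIntegral f = ∑' k : ℕ, ENNReal.ofReal k * ‖c k‖ₑ ^ 2 := by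
  have hd : DifferentiableOn ℂ (deriv f) disk := hf.deriv isOpen_disk
  have hc : coeff f = c := (hasCoeffs_coeff hf).unique h
  rw [dirichletIntegral, areaSq_eq (hasCoeffs_coeff hd) hd.continuousOn,
    tsum_eq_zero_add' (f := fun k : ℕ => ENNReal.ofReal k * ‖c k‖ₑ ^ 2) ENNReal.summable]
  simp only [Nat.cast_zero, ENNReal.ofReal_zero, zero_mul, zero_add]
  refine tsum_congr fun k => ?_
  have h1 : ‖((k : ℂ) + 1)‖ₑ = ENNReal.ofReal (k + 1) := by
    rw [← ofReal_norm]
    congr 1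
    exact_mod_cast Complex.norm_natCast (k + 1)
  rw [coeff_deriv, hc, enorm_mul, mul_pow, ← mul_assoc, h1, ← ENNReal.ofReal_pow (by positivity),
    ← ENNReal.ofReal_mul (by positivity)]
  congr 2
  push_cast
  field_simp

end Coefficients

/-! ### Weighted spaces as copies of `ℓ²`, and the matrix of a composition operator -/

section Weighted

lemma comp_apply (φ : SelfMap) (f : Hol) {z : ℂ} (hz : z ∈ disk) :
    (comp φ f : ℂ → ℂ) z = (f : ℂ → ℂ) (φ.toFun z) :=
  Set.indicator_of_mem (f := fun z => (f : ℂ → ℂ) (φ.toFun z)) hz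

lemma coeff_add (f g : Hol) :
    coeff ((f + g : Hol) : ℂ → ℂ) = coeff (f : ℂ → ℂ) + coeff (g : ℂ → ℂ) := by
  refine (hasCoeffs_coeff (f + g).2.1).unique fun z hz => ?_
  have := (hasCoeffs_coeff f.2.1 z hz).add (hasCoeffs_coeff g.2.1 z hz)
  exact hasSum_of_eq (fun k => by simp [add_mul]) this

lemma coeff_smul (a : ℂ) (f : Hol) :
    coeff ((a • f : Hol) : ℂ → ℂ) = a • coeff (f : ℂ → ℂ) := by
  refine (hasCoeffs_coeff (a • f).2.1).unique fun z hz => ?_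
  have := (hasCoeffs_coeff f.2.1 z hz).mul_left a
  exact hasSum_of_eq (fun k => by simp [mul_assoc]) this

namespace ExtNorm

variable {N : ExtNorm}

lemma root_ne_top_iff {f : Hol} : N.root f ≠ ∞ ↔ N.sq f ≠ ∞ := by
  rw [root, Ne, ENNReal.rpow_eq_top_iff_of_pos (by norm_num)]

lemma Space.sq_ne_top (f : N.Space) : N.sq f.toHol ≠ ∞ := root_ne_top_iff.1 f.root_ne_top

/-- An analytic function of finite norm, as an element of the space. -/
def Space.mk (f : Hol) (hf : N.sq f ≠ ∞) : N.Space :=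
  (⟨f, root_ne_top_iff.2 hf⟩ : N.finite)

@[simp] lemma Space.toHol_mk (f : Hol) (hf : N.sq f ≠ ∞) : (Space.mk f hf).toHol = f := rfl

lemma Space.norm_sq (f : N.Space) : ‖f‖ ^ 2 = (N.sq f.toHol).toReal := by
  rw [Space.norm_def, root, ← ENNReal.toReal_rpow, ← Real.sqrt_eq_rpow,
    Real.sq_sqrt ENNReal.toReal_nonneg]

end ExtNorm

/-- The norm of `N` is a weighted `ℓ²` norm of the Taylor coefficients, with weights bounded below
by those of the Bergman space. -/
structure IsWeighted (N : ExtNorm) (w : ℕ → ℝ) : Prop where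
  le : ∀ k : ℕ, 1 / ((k : ℝ) + 1) ≤ w k
  sq_eq : ∀ f : Hol, N.sq f = ∑' k, ENNReal.ofReal (w k) * ‖coeff (f : ℂ → ℂ) k‖ₑ ^ 2

namespace IsWeighted

variable {N : ExtNorm} {w : ℕ → ℝ}

lemma pos (h : IsWeighted N w) (k : ℕ) : 0 < w k :=
  lt_of_lt_of_le (by positivity) (h.le k)

lemma sqrt_pos (h : IsWeighted N w) (k : ℕ) : 0 < √(w k) := Real.sqrt_pos.2 (h.pos k)

lemma sq_eq_tsum_ofReal (h : IsWeighted N w) (f : Hol) : N.sq f =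
    ∑' k, ENNReal.ofReal (‖(√(w k) : ℂ) * coeff (f : ℂ → ℂ) k‖ ^ 2) := by
  rw [h.sq_eq]
  refine tsum_congr fun k => ?_
  rw [norm_mul, Complex.norm_real, Real.norm_of_nonneg (Real.sqrt_nonneg _), mul_pow,
    Real.sq_sqrt (h.pos k).le, ENNReal.ofReal_mul (h.pos k).le,
    ENNReal.ofReal_pow (norm_nonneg _), ofReal_norm]

lemma summable_sq (h : IsWeighted N w) (f : N.Space) :
    Summable fun k => ‖(√(w k) : ℂ) * coeff (f.toHol : ℂ → ℂ) k‖ ^ 2 := by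
  refine ENNReal.summable_toReal (f := fun k => ENNReal.ofReal
    (‖(√(w k) : ℂ) * coeff (f.toHol : ℂ → ℂ) k‖ ^ 2)) ?_ |>.congr fun k => ?_
  · rw [← h.sq_eq_tsum_ofReal]; exact f.sq_ne_top
  · rw [ENNReal.toReal_ofReal (by positivity)]

/-- The sequence of normalized Taylor coefficients. -/
def toSeqLinear (h : IsWeighted N w) : N.Space →ₗᵢ[ℂ] SeqSpace where
  toFun f := ⟨fun k => √(w k) * coeff (f.toHol : ℂ → ℂ) k, by
    refine memℓp_gen ?_
    simpa using h.summable_sq f⟩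
  map_add' f g := by
    ext k
    change (√(w k) : ℂ) * coeff ((f.toHol + g.toHol : Hol) : ℂ → ℂ) k = _ + _
    rw [coeff_add, Pi.add_apply, mul_add]
  map_smul' a f := by
    ext k
    simp only [map_smul, coeff_smul, Pi.smul_apply, smul_eq_mul, RingHom.id_apply, lp.coeFn_smul]
    ring
  norm_map' f := by
    refine (sq_eq_sq₀ (norm_nonneg _) (norm_nonneg _)).1 ?_
    rw [f.norm_sq, h.sq_eq_tsum_ofReal, ← ENNReal.ofReal_tsum_of_nonneg
      (fun k => by positivity) (h.summable_sq f), ENNReal.toReal_ofReal (tsum_nonneg fun k => by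
        positivity)]
    have := lp.norm_rpow_eq_tsum (p := 2) (E := fun _ : ℕ => ℂ) (by norm_num)
      ⟨fun k => √(w k) * coeff (f.toHol : ℂ → ℂ) k, by
        refine memℓp_gen ?_
        simpa using h.summable_sq f⟩
    simpa using this

lemma surjective_toSeqLinear (h : IsWeighted N w) : Function.Surjective h.toSeqLinear := by
  intro x
  have hxs : Summable fun k => ‖x k‖ ^ 2 := by
    have := (lp.memℓp x).summable (by norm_num)
    simpa using this
  obtain ⟨f, hf⟩ := exists_hasCoeffs (c := fun k => x k / √(w k)) (fun r hr0 hr => by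
    have hs : Summable fun k : ℕ => ‖x‖ * (((k : ℝ) ^ 1 * r ^ k) + r ^ k) :=
      ((summable_pow_mul_geometric_of_norm_lt_one 1 (by simpa [abs_of_nonneg hr0] using hr)).add
        (summable_geometric_of_lt_one hr0 hr)).mul_left _
    refine Summable.of_nonneg_of_le (fun k => by positivity) (fun k => ?_) hs
    have h1 : 1 / √(w k) ≤ k + 1 := by
      rw [div_le_iff₀ (h.sqrt_pos k)]
      have h2 : √(1 / ((k : ℝ) + 1)) ≤ √(w k) := Real.sqrt_le_sqrt (h.le k)
      have h3 : 1 / ((k : ℝ) + 1) ≤ √(1 / ((k : ℝ) + 1)) := by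
        refine Real.le_sqrt_of_sq_le ?_
        have : 1 / ((k : ℝ) + 1) ≤ 1 := by
          rw [div_le_one (by positivity)]; linarith [(Nat.cast_nonneg k : (0 : ℝ) ≤ k)]
        have h0 : 0 ≤ 1 / ((k : ℝ) + 1) := by positivity
        nlinarith
      have h4 := h3.trans h2
      rw [div_le_iff₀ (by positivity)] at h4
      linarith
    have hx : ‖x k‖ ≤ ‖x‖ := lp.norm_apply_le_norm (by norm_num) x k
    rw [norm_div, Complex.norm_real, Real.norm_of_nonneg (h.sqrt_pos k).le]
    calc ‖x k‖ / √(w k) * r ^ k = ‖x k‖ * (1 / √(w k)) * r ^ k := by ring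
      _ ≤ ‖x‖ * (k + 1) * r ^ k := by
        have := (h.sqrt_pos k).le
        gcongr
      _ = ‖x‖ * ((k : ℝ) ^ 1 * r ^ k + r ^ k) := by ring)
  have hc : coeff (f : ℂ → ℂ) = fun k => x k / √(w k) := (hasCoeffs_coeff f.2.1).unique hf
  have hx : ∀ k, (√(w k) : ℂ) * coeff (f : ℂ → ℂ) k = x k := fun k => by
    rw [hc]
    have : (√(w k) : ℂ) ≠ 0 := by exact_mod_cast (h.sqrt_pos k).ne'
    field_simp
  have hfin : N.sq f ≠ ∞ := by
    rw [h.sq_eq_tsum_ofReal]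
    simp_rw [hx]
    rw [← ENNReal.ofReal_tsum_of_nonneg (fun k => by positivity) hxs]
    exact ENNReal.ofReal_ne_top
  refine ⟨ExtNorm.Space.mk f hfin, ?_⟩
  ext k
  exact hx k

/-- A weighted space of analytic functions is isometric to `ℓ²`. -/
def toSeq (h : IsWeighted N w) : N.Space ≃ₗᵢ[ℂ] SeqSpace :=
  LinearIsometryEquiv.ofSurjective h.toSeqLinear h.surjective_toSeqLinear

lemma toSeq_apply (h : IsWeighted N w) (f : N.Space) (k : ℕ) :
    h.toSeq f k = √(w k) * coeff (f.toHol : ℂ → ℂ) k := rfl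

/-- The operator on `ℓ²` that corresponds to an operator on the weighted space. -/
def conj (h : IsWeighted N w) (T : N.Space →L[ℂ] N.Space) : SeqSpace →L[ℂ] SeqSpace :=
  (h.toSeq.toContinuousLinearEquiv : N.Space →L[ℂ] SeqSpace) ∘L T ∘L
    (h.toSeq.symm.toContinuousLinearEquiv : SeqSpace →L[ℂ] N.Space)

lemma conj_apply (h : IsWeighted N w) (T : N.Space →L[ℂ] N.Space) (x : SeqSpace) :
    h.conj T x = h.toSeq (T (h.toSeq.symm x)) := rfl

lemma enorm_equiv_le_one {E F : Type} [NormedAddCommGroup E] [NormedSpace ℂ E]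
    [NormedAddCommGroup F] [NormedSpace ℂ F] (e : E ≃ₗᵢ[ℂ] F) :
    ‖(e.toContinuousLinearEquiv : E →L[ℂ] F)‖ₑ ≤ 1 := by
  rw [← ofReal_norm, ENNReal.ofReal_le_one]
  exact ContinuousLinearMap.opNorm_le_bound _ zero_le_one fun x => by simp

lemma approxNumber_conj (h : IsWeighted N w) (T : N.Space →L[ℂ] N.Space) {n : ℕ} (hn : 1 ≤ n) :
    approxNumber (h.conj T) n = approxNumber T n := by
  have key : ∀ {E F : Type} [NormedAddCommGroup E] [NormedSpace ℂ E] [NormedAddCommGroup F]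
      [NormedSpace ℂ F] (e : E ≃ₗᵢ[ℂ] F) (T : E →L[ℂ] E),
      approxNumber ((e.toContinuousLinearEquiv : E →L[ℂ] F) ∘L T ∘L
        (e.symm.toContinuousLinearEquiv : F →L[ℂ] E)) n ≤ approxNumber T n := by
    intro E F _ _ _ _ e T
    refine (approxNumber_comp_le _ _ _ hn).trans ?_
    refine mul_le_of_le_one_left' ?_
    exact mul_le_one' (enorm_equiv_le_one e) (enorm_equiv_le_one e.symm)
  refine le_antisymm (key h.toSeq T) ?_
  refine le_trans (le_of_eq ?_) (key h.toSeq.symm (h.conj T))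
  congr 1
  ext x
  simp [conj]

/-- The unit vectors of `ℓ²` correspond to the normalized monomials. -/
lemma toSeq_symm_unitVec_apply (h : IsWeighted N w) (k : ℕ) {z : ℂ} (hz : z ∈ disk) :
    ((h.toSeq.symm (unitVec k)).toHol : ℂ → ℂ) z = z ^ k / √(w k) := by
  set f := h.toSeq.symm (unitVec k) with hf
  have h1 : ∀ m, (√(w m) : ℂ) * coeff (f.toHol : ℂ → ℂ) m = if m = k then 1 else 0 := fun m => by
    rw [← h.toSeq_apply, hf, LinearIsometryEquiv.apply_symm_apply, unitVec_apply]
  have h2 := hasCoeffs_coeff f.toHol.2.1 z hz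
  refine h2.unique (hasSum_of_eq (fun m => ?_) (hasSum_ite_eq k (z ^ k / √(w k) : ℂ)))
  have hm : (√(w m) : ℂ) ≠ 0 := by exact_mod_cast (h.sqrt_pos m).ne'
  have h3 := h1 m
  by_cases hmk : m = k
  · subst hmk
    rw [if_pos rfl] at h3 ⊢
    have h4 : coeff (f.toHol : ℂ → ℂ) m = 1 / √(w m) := eq_div_of_mul_eq hm (by rwa [mul_comm])
    rw [h4]
    ring
  · rw [if_neg hmk] at h3 ⊢
    rw [(mul_eq_zero.1 h3).resolve_left hm, zero_mul]

/-- The matrix of a composition operator in the normalized monomials: the coefficients of `φ ^ k`,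
rescaled by the weights. -/
lemma conj_unitVec (h : IsWeighted N w) {φ : SelfMap} {T : N.Space →L[ℂ] N.Space}
    (hT : IsCompOp N φ T) (m k : ℕ) :
    (h.conj T (unitVec k)) m = coeff (fun z => φ.toFun z ^ k) m * (√(w m) / √(w k)) := by
  rw [conj_apply, toSeq_apply, hT]
  have hc : coeff (comp φ (h.toSeq.symm (unitVec k)).toHol : ℂ → ℂ) =
      fun m => coeff (fun z => φ.toFun z ^ k) m / √(w k) := by
    refine (hasCoeffs_coeff (comp φ (h.toSeq.symm (unitVec k)).toHol).2.1).unique fun z hz => ?_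
    have h1 := (hasCoeffs_coeff (f := fun z => φ.toFun z ^ k) (φ.analytic.pow k) z hz).div_const
      (√(w k) : ℂ)
    have h2 : (comp φ (h.toSeq.symm (unitVec k)).toHol : ℂ → ℂ) z = φ.toFun z ^ k / √(w k) := by
      rw [← h.toSeq_symm_unitVec_apply k (φ.mapsTo hz)]
      exact comp_apply φ _ hz
    rw [h2]
    exact hasSum_of_eq (fun m => mul_div_right_comm _ _ _) h1
  rw [hc]
  ring

end IsWeighted

lemma coeff_pow_eq_zero {φ : SelfMap} (h0 : φ.toFun 0 = 0) {m k : ℕ} (hmk : m < k) :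
    coeff (fun z => φ.toFun z ^ k) m = 0 := by
  have han : AnalyticAt ℂ φ.toFun 0 := φ.analytic.analyticAt (isOpen_disk.mem_nhds zero_mem_disk)
  have hord : 1 ≤ analyticOrderAt φ.toFun 0 := by
    rw [Order.one_le_iff_ne_zero]
    exact han.analyticOrderAt_ne_zero.2 h0
  have h1 : (k : ℕ∞) ≤ analyticOrderAt (φ.toFun ^ k) 0 := by
    rw [analyticOrderAt_pow han, nsmul_eq_mul]
    exact le_mul_of_one_le_right' hord
  have h2 := (natCast_le_analyticOrderAt_iff_iteratedDeriv_eq_zero (han.pow k)).1 h1 m hmk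
  rw [coeff]
  change _ * iteratedDeriv m (φ.toFun ^ k) 0 = 0
  rw [h2, mul_zero]

/-- For a symbol that fixes the origin, the matrices of `C_φ` on two weighted spaces are conjugate
by the diagonal matrix with entries `√(w k / w' k)`. -/
theorem prod_approxNumber_le_of_weighted {N N' : ExtNorm} {w w' : ℕ → ℝ} (h : IsWeighted N w)
    (h' : IsWeighted N' w') (hmono : Monotone fun k => w k / w' k) {φ : SelfMap}
    (h0 : φ.toFun 0 = 0) {T : N.Space →L[ℂ] N.Space} {T' : N'.Space →L[ℂ] N'.Space}
    (hT : IsCompOp N φ T) (hT' : IsCompOp N' φ T') (n : ℕ) :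
    ∏ j ∈ Finset.Icc 1 n, approxNumber T' j ≤ ∏ j ∈ Finset.Icc 1 n, approxNumber T j := by
  have e1 : ∏ j ∈ Finset.Icc 1 n, approxNumber T j =
      ∏ j ∈ Finset.Icc 1 n, approxNumber (h.conj T) j :=
    Finset.prod_congr rfl fun j hj => (h.approxNumber_conj T (Finset.mem_Icc.1 hj).1).symm
  have e2 : ∏ j ∈ Finset.Icc 1 n, approxNumber T' j =
      ∏ j ∈ Finset.Icc 1 n, approxNumber (h'.conj T') j :=
    Finset.prod_congr rfl fun j hj => (h'.approxNumber_conj T' (Finset.mem_Icc.1 hj).1).symm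
  rw [e1, e2]
  refine prod_approxNumber_le_of_triangular (d := fun k => √(w k / w' k))
    (fun k => Real.sqrt_pos.2 (div_pos (h.pos k) (h'.pos k)))
    (fun a b hab => Real.sqrt_le_sqrt (hmono hab)) (fun m k hmk => ?_) (fun m k => ?_) n
  · rw [h.conj_unitVec hT, coeff_pow_eq_zero h0 hmk, zero_mul]
  · rw [h.conj_unitVec hT, h'.conj_unitVec hT', mul_assoc]
    congr 1
    have h1 := h.sqrt_pos k
    have h2 := h.sqrt_pos m
    have h3 := h'.sqrt_pos k
    have h4 := h'.sqrt_pos m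
    rw [← Complex.ofReal_div, ← Complex.ofReal_div, ← Complex.ofReal_mul,
      Real.sqrt_div (h.pos k).le, Real.sqrt_div (h.pos m).le]
    congr 1
    field_simp

lemma isWeighted_hardy : IsWeighted hardy fun _ => 1 where
  le k := by
    rw [div_le_one (by positivity)]; linarith [(Nat.cast_nonneg k : (0 : ℝ) ≤ k)]
  sq_eq f := by
    change hardySq f = _
    simpa using hardySq_eq (hasCoeffs_coeff f.2.1) f.2.1.continuousOn

lemma isWeighted_bergman : IsWeighted bergman fun k => 1 / ((k : ℝ) + 1) where
  le _ := le_rfl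
  sq_eq f := areaSq_eq (hasCoeffs_coeff f.2.1) f.2.1.continuousOn

lemma isWeighted_dirichlet : IsWeighted dirichlet fun k => max 1 (k : ℝ) where
  le k := (isWeighted_hardy.le k).trans (le_max_left _ _)
  sq_eq f := by
    have hc := hasCoeffs_coeff f.2.1
    change ‖(f : ℂ → ℂ) 0‖ₑ ^ 2 + dirichletIntegral f = _
    rw [dirichletIntegral_eq hc f.2.1, hc.eval_zero,
      tsum_eq_zero_add' (f := fun k : ℕ => ENNReal.ofReal k * _) ENNReal.summable,
      tsum_eq_zero_add' (f := fun k : ℕ => ENNReal.ofReal (max 1 (k : ℝ)) * _) ENNReal.summable]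
    simp

lemma isWeighted_dirichletAlt : IsWeighted dirichletAlt fun k => (k : ℝ) + 1 where
  le k := (isWeighted_hardy.le k).trans (by linarith [(Nat.cast_nonneg k : (0 : ℝ) ≤ k)])
  sq_eq f := by
    have hc := hasCoeffs_coeff f.2.1
    change hardySq f + dirichletIntegral f = _
    rw [dirichletIntegral_eq hc f.2.1, hardySq_eq hc f.2.1.continuousOn, ← ENNReal.tsum_add]
    refine tsum_congr fun k => ?_
    rw [ENNReal.ofReal_add (by positivity) zero_le_one]
    simp
    ring

end Weighted

/-! ### Subordination -/

section Subordination

lemma circleMeanSq_le_of_le {f g : ℂ → ℂ} {C : ℝ≥0∞} (hC : C ≠ ∞)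
    (h : ∀ z ∈ disk, ‖f z‖ₑ ^ 2 ≤ C * ‖g z‖ₑ ^ 2) {r : ℝ} (hr : r ∈ Set.Ioo (0 : ℝ) 1) :
    circleMeanSq r f ≤ C * circleMeanSq r g := by
  rw [circleMeanSq, circleMeanSq, ← lintegral_const_mul' _ _ hC]
  exact lintegral_mono fun t => h _ (circle_mem_disk hr t)

lemma circleMeanSq_le_hardySq (f : ℂ → ℂ) {r : ℝ} (hr : r ∈ Set.Ioo (0 : ℝ) 1) :
    circleMeanSq r f ≤ hardySq f :=
  le_iSup₂ (f := fun r (_ : r ∈ Set.Ioo (0 : ℝ) 1) => circleMeanSq r f) r hr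

lemma hardySq_le_of_le {f g : ℂ → ℂ} {C : ℝ≥0∞} (hC : C ≠ ∞)
    (h : ∀ z ∈ disk, ‖f z‖ₑ ^ 2 ≤ C * ‖g z‖ₑ ^ 2) : hardySq f ≤ C * hardySq g :=
  iSup₂_le fun r hr => (circleMeanSq_le_of_le hC h hr).trans
    (by gcongr; exact circleMeanSq_le_hardySq g hr)

lemma hardySq_congr {f g : ℂ → ℂ} (h : ∀ z ∈ disk, f z = g z) : hardySq f = hardySq g := by
  refine le_antisymm ?_ ?_
  · simpa using hardySq_le_of_le (C := 1) (by simp) fun z hz => by rw [h z hz, one_mul]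
  · simpa using hardySq_le_of_le (C := 1) (by simp) fun z hz => by rw [h z hz, one_mul]

lemma enorm_eval_zero_sq_le_hardySq {f : ℂ → ℂ} (hf : DifferentiableOn ℂ f disk) :
    ‖f 0‖ₑ ^ 2 ≤ hardySq f := by
  have hc := hasCoeffs_coeff hf
  rw [hardySq_eq hc hf.continuousOn, hc.eval_zero]
  exact ENNReal.le_tsum 0

lemma norm_lt_one_of_mem {z : ℂ} (hz : z ∈ disk) : ‖z‖ < 1 := mem_disk_iff.1 hz

/-- The reproducing kernel of the Hardy space at the point `b`. -/
def szegoKernel (b z : ℂ) : ℂ := (1 - starRingEnd ℂ b * z)⁻¹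

lemma norm_conj_mul_lt_one {b z : ℂ} (hb : b ∈ disk) (hz : z ∈ disk) :
    ‖starRingEnd ℂ b * z‖ < 1 := by
  rw [norm_mul, RCLike.norm_conj]
  have h1 := norm_lt_one_of_mem hb
  have h2 := norm_lt_one_of_mem hz
  nlinarith [norm_nonneg b, norm_nonneg z]

lemma one_sub_conj_mul_ne_zero {b z : ℂ} (hb : b ∈ disk) (hz : z ∈ disk) :
    1 - starRingEnd ℂ b * z ≠ 0 := by
  intro h
  have := norm_conj_mul_lt_one hb hz
  rw [← sub_eq_zero.1 h] at this
  simp at this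

lemma hasCoeffs_szegoKernel {b : ℂ} (hb : b ∈ disk) :
    HasCoeffs (szegoKernel b) fun k => starRingEnd ℂ b ^ k := by
  intro z hz
  have := hasSum_geometric_of_norm_lt_one (norm_conj_mul_lt_one hb hz)
  exact hasSum_of_eq (fun k => mul_pow _ _ _) this

lemma differentiableOn_szegoKernel {b : ℂ} (hb : b ∈ disk) :
    DifferentiableOn ℂ (szegoKernel b) disk := by
  intro z hz
  refine DifferentiableAt.differentiableWithinAt ?_
  exact DifferentiableAt.inv (by fun_prop) (one_sub_conj_mul_ne_zero hb hz)

lemma hardySq_szegoKernel_ne_top {b : ℂ} (hb : b ∈ disk) : hardySq (szegoKernel b) ≠ ∞ := by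
  rw [hardySq_eq (hasCoeffs_szegoKernel hb) (differentiableOn_szegoKernel hb).continuousOn]
  have hs : Summable fun k : ℕ => (‖b‖ ^ 2) ^ k := by
    refine summable_geometric_of_lt_one (by positivity) ?_
    have := norm_lt_one_of_mem hb
    nlinarith [norm_nonneg b]
  have h1 : ∀ k : ℕ, ‖starRingEnd ℂ b ^ k‖ₑ ^ 2 = ENNReal.ofReal ((‖b‖ ^ 2) ^ k) := fun k => by
    rw [← ofReal_norm, ← ENNReal.ofReal_pow (norm_nonneg _), norm_pow, RCLike.norm_conj,
      ← pow_mul, ← pow_mul, mul_comm]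
  simp_rw [h1]
  rw [← ENNReal.ofReal_tsum_of_nonneg (fun k => by positivity) hs]
  exact ENNReal.ofReal_ne_top

/-- The Szegő kernel at `b` is orthogonal to the functions that vanish at `b`, which gives
Pythagoras' theorem; only `≤` is needed, also when `g` has infinite norm. -/
lemma hardySq_kernel_add_le {b : ℂ} (hb : b ∈ disk) (a : ℂ) {g : ℂ → ℂ}
    (hg : DifferentiableOn ℂ g disk) (hgb : g b = 0) :
    hardySq (fun z => a * szegoKernel b z + g z) ≤
      ‖a‖ₑ ^ 2 * hardySq (szegoKernel b) + hardySq g := by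
  rcases eq_or_ne (hardySq g) ∞ with htop | htop
  · simp [htop]
  set c := coeff g with hc
  have hcg : HasCoeffs g c := hasCoeffs_coeff hg
  have hk := hasCoeffs_szegoKernel hb
  have hkd := differentiableOn_szegoKernel hb
  have hsum : HasCoeffs (fun z => a * szegoKernel b z + g z)
      fun k => a * starRingEnd ℂ b ^ k + c k := fun z hz =>
    hasSum_of_eq (fun k => by ring) (((hk z hz).mul_left a).add (hcg z hz))
  have hsq : ∀ x : ℂ, ‖x‖ₑ ^ 2 = ENNReal.ofReal (‖x‖ ^ 2) := fun x => by
    rw [ENNReal.ofReal_pow (norm_nonneg _), ofReal_norm]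
  have hsummable : ∀ {d : ℕ → ℂ}, ∑' k, ‖d k‖ₑ ^ 2 ≠ ∞ → Summable fun k => ‖d k‖ ^ 2 := by
    intro d hd
    simp_rw [hsq] at hd
    exact (ENNReal.summable_toReal hd).congr fun k => ENNReal.toReal_ofReal (by positivity)
  have h1 : Summable fun k => ‖c k‖ ^ 2 := hsummable (by
    rwa [← hardySq_eq hcg hg.continuousOn])
  have h2 : Summable fun k => ‖starRingEnd ℂ b ^ k‖ ^ 2 := hsummable (by
    rw [← hardySq_eq hk hkd.continuousOn]; exact hardySq_szegoKernel_ne_top hb)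
  have h3 : HasSum (fun k => 2 * (starRingEnd ℂ a * (c k * b ^ k)).re) 0 := by
    have h := ((hcg b hb).mul_left (starRingEnd ℂ a))
    have := (Complex.hasSum_re h).mul_left 2
    simpa [hgb] using this
  have hpt : ∀ k, ‖a * starRingEnd ℂ b ^ k + c k‖ ^ 2 =
      ‖a‖ ^ 2 * ‖starRingEnd ℂ b ^ k‖ ^ 2 + ‖c k‖ ^ 2 +
        2 * (starRingEnd ℂ a * (c k * b ^ k)).re := fun k => by
    rw [← mul_pow, ← norm_mul, ← Complex.normSq_eq_norm_sq, ← Complex.normSq_eq_norm_sq,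
      ← Complex.normSq_eq_norm_sq, Complex.normSq_add]
    congr 2
    rw [← Complex.conj_re]
    congr 1
    simp only [map_mul, map_pow, Complex.conj_conj]
    ring
  have htot := ((h2.hasSum.mul_left (‖a‖ ^ 2)).add h1.hasSum).add h3
  simp_rw [← hpt, add_zero] at htot
  rw [hardySq_eq hsum (((hkd.const_mul a).add hg).continuousOn), hardySq_eq hcg hg.continuousOn,
    hardySq_eq hk hkd.continuousOn]
  simp_rw [hsq]
  rw [← ENNReal.ofReal_tsum_of_nonneg (fun k => by positivity) htot.summable,
    ← ENNReal.ofReal_tsum_of_nonneg (fun k => by positivity) h1,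
    ← ENNReal.ofReal_tsum_of_nonneg (fun k => by positivity) h2, htot.tsum_eq,
    ← ENNReal.ofReal_mul (by positivity), ← ENNReal.ofReal_add
      (mul_nonneg (by positivity) (tsum_nonneg fun k => by positivity))
      (tsum_nonneg fun k => by positivity)]

/-- Littlewood's subordination principle on polynomials, weighted by the Szegő kernel at a zero of
the symbol. Splitting off the constant term, `p = c 0 + w * q w` gives an orthogonal decomposition
of `k * (p ∘ ψ)`, and multiplication by `ψ` is a contraction. -/
lemma hardySq_kernel_mul_polynomial_le {b : ℂ} (hb : b ∈ disk) (ψ : SelfMap) (hψ : ψ.toFun b = 0)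
    (n : ℕ) (c : ℕ → ℂ) :
    hardySq (fun z => szegoKernel b z * ∑ j ∈ Finset.range n, c j * ψ.toFun z ^ j) ≤
      hardySq (szegoKernel b) * ∑ j ∈ Finset.range n, ‖c j‖ₑ ^ 2 := by
  induction n generalizing c with
  | zero => simp [hardySq, circleMeanSq]
  | succ n ih =>
    set h : ℂ → ℂ := fun z =>
      szegoKernel b z * ∑ j ∈ Finset.range n, c (j + 1) * ψ.toFun z ^ j with hh
    have hsplit : (fun z => szegoKernel b z * ∑ j ∈ Finset.range (n + 1), c j * ψ.toFun z ^ j) =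
        fun z => c 0 * szegoKernel b z + ψ.toFun z * h z := by
      funext z
      rw [Finset.sum_range_succ', hh]
      have : ∀ j, c (j + 1) * ψ.toFun z ^ (j + 1) =
          ψ.toFun z * (c (j + 1) * ψ.toFun z ^ j) := fun j => by ring
      simp_rw [this]
      rw [← Finset.mul_sum]
      ring
    have hhd : DifferentiableOn ℂ h disk :=
      (differentiableOn_szegoKernel hb).mul
        (DifferentiableOn.fun_sum fun j _ => (ψ.analytic.pow j).const_mul _)
    rw [hsplit, Finset.sum_range_succ']
    refine (hardySq_kernel_add_le hb (c 0) (ψ.analytic.mul hhd) (by simp [hψ])).trans ?_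
    rw [mul_add, add_comm, mul_comm (‖c 0‖ₑ ^ 2)]
    gcongr
    refine le_trans ?_ (ih fun j => c (j + 1))
    have := hardySq_le_of_le (f := fun z => ψ.toFun z * h z) (g := h) (C := 1) (by simp)
      fun z hz => by
        have h1 : ‖ψ.toFun z‖ₑ ≤ 1 := by
          rw [← ofReal_norm, ENNReal.ofReal_le_one]
          exact (norm_lt_one_of_mem (ψ.mapsTo hz)).le
        rw [enorm_mul, mul_pow]
        gcongr
        exact pow_le_one₀ bot_le h1
    rw [one_mul] at this
    exact this

/-- Boundedness of composition on the Hardy space for a symbol that vanishes at `b`. The factor `4`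
bounds `|1 - conj b * z|²`; general functions are reached from their Taylor polynomials by Fatou's
lemma. -/
lemma hardySq_comp_le {b : ℂ} (hb : b ∈ disk) (ψ : SelfMap) (hψ : ψ.toFun b = 0) {f : ℂ → ℂ}
    (hf : DifferentiableOn ℂ f disk) :
    hardySq (fun z => f (ψ.toFun z)) ≤ 4 * hardySq (szegoKernel b) * hardySq f := by
  have hc := hasCoeffs_coeff hf
  set S : ℕ → ℂ → ℂ := fun n z => ∑ j ∈ Finset.range n, coeff f j * ψ.toFun z ^ j with hS
  have hSle : ∀ n, hardySq (S n) ≤ 4 * hardySq (szegoKernel b) * hardySq f := by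
    intro n
    have h1 : hardySq (S n) ≤ 4 * hardySq fun z => szegoKernel b z * S n z := by
      refine hardySq_le_of_le (by simp) fun z hz => ?_
      have hne := one_sub_conj_mul_ne_zero hb hz
      have h2 : S n z = (1 - starRingEnd ℂ b * z) * (szegoKernel b z * S n z) := by
        rw [szegoKernel, ← mul_assoc, mul_inv_cancel₀ hne, one_mul]
      have h3 : ‖(1 - starRingEnd ℂ b * z)‖ₑ ≤ 2 := by
        rw [← ofReal_norm, ← ENNReal.ofReal_ofNat]
        refine ENNReal.ofReal_le_ofReal ((norm_sub_le _ _).trans ?_)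
        have := norm_conj_mul_lt_one hb hz
        rw [norm_one]
        linarith
      conv_lhs => rw [h2]
      rw [enorm_mul, mul_pow]
      gcongr
      calc ‖(1 - starRingEnd ℂ b * z)‖ₑ ^ 2 ≤ 2 ^ 2 := by gcongr
        _ = 4 := by norm_num
    refine h1.trans ?_
    rw [mul_assoc]
    gcongr
    refine (hardySq_kernel_mul_polynomial_le hb ψ hψ n (coeff f)).trans ?_
    gcongr
    rw [hardySq_eq hc hf.continuousOn]
    exact ENNReal.sum_le_tsum _
  refine iSup₂_le fun r hr => ?_
  have hcircle : ∀ t : ℝ, Filter.Tendsto (fun n => ‖S n (r * Complex.exp (t * Complex.I))‖ₑ ^ 2)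
      Filter.atTop (nhds (‖f (ψ.toFun (r * Complex.exp (t * Complex.I)))‖ₑ ^ 2)) := fun t => by
    have := (hc _ (ψ.mapsTo (circle_mem_disk hr t))).tendsto_sum_nat
    exact ((ENNReal.continuous_pow 2).tendsto _).comp (this.enorm)
  have hmeas : ∀ n, Measurable fun t : ℝ => ‖S n (r * Complex.exp (t * Complex.I))‖ₑ ^ 2 := fun n =>
    have : Continuous fun t : ℝ => S n (r * Complex.exp (t * Complex.I)) := by
      have hψc : Continuous fun t : ℝ => ψ.toFun (r * Complex.exp (t * Complex.I)) :=
        ψ.analytic.continuousOn.comp_continuous (by fun_prop) (circle_mem_disk hr)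
      exact continuous_finsetSum _ fun j _ => continuous_const.mul (hψc.pow j)
    this.measurable.enorm.pow_const 2
  calc circleMeanSq r (fun z => f (ψ.toFun z))
      = ∫⁻ t, Filter.liminf (fun n => ‖S n (r * Complex.exp (t * Complex.I))‖ₑ ^ 2)
          Filter.atTop ∂arcMeasure := lintegral_congr fun t => (hcircle t).liminf_eq.symm
    _ ≤ Filter.liminf (fun n => circleMeanSq r (S n)) Filter.atTop := lintegral_liminf_le hmeas
    _ ≤ 4 * hardySq (szegoKernel b) * hardySq f :=
        Filter.liminf_le_of_le (by isBoundedDefault) fun x hx => by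
          obtain ⟨n, hn⟩ := hx.exists
          exact hn.trans ((circleMeanSq_le_hardySq _ hr).trans (hSle n))

lemma hardySq_dilate {g : ℂ → ℂ} (hg : DifferentiableOn ℂ g disk) {r : ℝ}
    (hr : r ∈ Set.Ioo (0 : ℝ) 1) : hardySq (fun z => g (r * z)) = circleMeanSq r g := by
  have hmem : ∀ z ∈ disk, (r : ℂ) * z ∈ disk := fun z hz => by
    rw [mem_disk_iff] at hz ⊢
    rw [norm_mul, Complex.norm_real, Real.norm_of_nonneg hr.1.le]
    nlinarith [hr.1, hr.2, norm_nonneg z]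
  have hd : DifferentiableOn ℂ (fun z => g (r * z)) disk :=
    hg.comp (by fun_prop) hmem
  have hc : HasCoeffs (fun z => g (r * z)) fun k => coeff g k * r ^ k := fun z hz =>
    hasSum_of_eq (fun k => by ring) (hasCoeffs_coeff hg _ (hmem z hz))
  rw [hardySq_eq hc hd.continuousOn, circleMeanSq_eq (hasCoeffs_coeff hg) hg.continuousOn hr]
  refine tsum_congr fun k => ?_
  rw [enorm_mul, mul_pow, mul_comm, ← ofReal_norm ((r : ℂ) ^ k), ← ENNReal.ofReal_pow
    (norm_nonneg _), norm_pow, Complex.norm_real, Real.norm_of_nonneg hr.1.le, ← pow_mul,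
    mul_comm k 2]

/-- By the Schwarz lemma, `z ↦ φ (r * z) / r` is again a symbol that fixes the origin, so that the
Hardy space estimate applies to the mean over every circle. -/
lemma areaSq_comp_le (φ : SelfMap) (h0 : φ.toFun 0 = 0) {f : ℂ → ℂ}
    (hf : DifferentiableOn ℂ f disk) :
    areaSq (fun z => f (φ.toFun z)) ≤ 4 * hardySq (szegoKernel 0) * areaSq f := by
  have hfφ : DifferentiableOn ℂ (fun z => f (φ.toFun z)) disk := hf.comp φ.analytic φ.mapsTo
  have hC : 4 * hardySq (szegoKernel 0) ≠ ∞ :=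
    ENNReal.mul_ne_top (by simp) (hardySq_szegoKernel_ne_top zero_mem_disk)
  rw [areaSq_eq_lintegral_circleMeanSq (hasCoeffs_coeff hfφ) hfφ.continuousOn,
    areaSq_eq_lintegral_circleMeanSq (hasCoeffs_coeff hf) hf.continuousOn,
    ← lintegral_const_mul' _ _ hC]
  refine setLIntegral_mono' measurableSet_Ioo fun r hr => ?_
  rw [mul_left_comm]
  gcongr
  have hr0 : (r : ℂ) ≠ 0 := by exact_mod_cast hr.1.ne'
  have hmem : ∀ z ∈ disk, (r : ℂ) * z ∈ disk := fun z hz => by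
    rw [mem_disk_iff] at hz ⊢
    rw [norm_mul, Complex.norm_real, Real.norm_of_nonneg hr.1.le]
    nlinarith [hr.1, hr.2, norm_nonneg z]
  have hschwarz : ∀ z ∈ disk, ‖φ.toFun z‖ ≤ ‖z‖ := fun z hz =>
    Complex.norm_le_norm_of_mapsTo_ball φ.analytic
      (φ.mapsTo.mono_right Metric.ball_subset_closedBall) h0 (norm_lt_one_of_mem hz)
  let ψ : SelfMap :=
    { toFun := fun z => φ.toFun (r * z) / r
      analytic := (φ.analytic.comp (by fun_prop) hmem).div_const _
      mapsTo := fun z hz => by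
        rw [mem_disk_iff, norm_div, Complex.norm_real, Real.norm_of_nonneg hr.1.le,
          div_lt_one hr.1]
        refine (hschwarz _ (hmem z hz)).trans_lt ?_
        rw [norm_mul, Complex.norm_real, Real.norm_of_nonneg hr.1.le]
        nlinarith [hr.1, norm_lt_one_of_mem hz] }
  have h1 := hardySq_comp_le zero_mem_disk ψ (by simp [ψ, h0]) (f := fun z => f (r * z))
    (hf.comp (by fun_prop) hmem)
  rw [hardySq_dilate hf hr] at h1
  rw [← hardySq_dilate hfφ hr]
  refine le_trans (le_of_eq ?_) h1
  refine hardySq_congr fun z _ => ?_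
  simp only [ψ]
  rw [mul_div_cancel₀ _ hr0]

end Subordination

/-! ### Automorphisms of the disk and boundedness -/

section Moebius

lemma neg_mem_disk {a : ℂ} (ha : a ∈ disk) : -a ∈ disk := by
  rw [mem_disk_iff] at ha ⊢
  rwa [norm_neg]

lemma one_add_conj_mul_ne_zero {a z : ℂ} (ha : a ∈ disk) (hz : z ∈ disk) :
    1 + starRingEnd ℂ a * z ≠ 0 := by
  have := one_sub_conj_mul_ne_zero (neg_mem_disk ha) hz
  rwa [map_neg, neg_mul, sub_neg_eq_add] at this

lemma norm_add_lt_norm_one_add {a z : ℂ} (ha : a ∈ disk) (hz : z ∈ disk) :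
    ‖z + a‖ < ‖1 + starRingEnd ℂ a * z‖ := by
  have h1 : ‖a‖ ^ 2 < 1 := by have := norm_lt_one_of_mem ha; nlinarith [norm_nonneg a]
  have h2 : ‖z‖ ^ 2 < 1 := by have := norm_lt_one_of_mem hz; nlinarith [norm_nonneg z]
  refine lt_of_pow_lt_pow_left₀ 2 (norm_nonneg _) ?_
  rw [← Complex.normSq_eq_norm_sq, Complex.normSq_apply] at h1 h2 ⊢
  rw [← Complex.normSq_eq_norm_sq, Complex.normSq_apply]
  simp only [Complex.add_re, Complex.add_im, Complex.one_re, Complex.one_im, Complex.mul_re,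
    Complex.mul_im, Complex.conj_re, Complex.conj_im]
  nlinarith [mul_pos (sub_pos.2 h1) (sub_pos.2 h2)]

/-- The automorphism `z ↦ (z + a) / (1 + conj a * z)` of the disk, which maps `0` to `a`. -/
def moebius (a : ℂ) (ha : a ∈ disk) : SelfMap where
  toFun z := (z + a) / (1 + starRingEnd ℂ a * z)
  analytic := by
    intro z hz
    refine DifferentiableAt.differentiableWithinAt ?_
    exact DifferentiableAt.div (by fun_prop) (by fun_prop) (one_add_conj_mul_ne_zero ha hz)
  mapsTo z hz := by
    rw [mem_disk_iff, norm_div, div_lt_one (norm_pos_iff.2 (one_add_conj_mul_ne_zero ha hz))]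
    exact norm_add_lt_norm_one_add ha hz

lemma moebius_apply (a : ℂ) (ha : a ∈ disk) (z : ℂ) :
    (moebius a ha).toFun z = (z + a) / (1 + starRingEnd ℂ a * z) := rfl

lemma moebius_neg_self (a : ℂ) (ha : a ∈ disk) : (moebius a ha).toFun (-a) = 0 := by
  simp [moebius_apply]

lemma moebius_moebius_neg (a : ℂ) (ha : a ∈ disk) {z : ℂ} (hz : z ∈ disk) :
    (moebius a ha).toFun ((moebius (-a) (neg_mem_disk ha)).toFun z) = z := by
  have h1 := one_add_conj_mul_ne_zero (neg_mem_disk ha) hz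
  have h3 := one_add_conj_mul_ne_zero ha ((moebius (-a) (neg_mem_disk ha)).mapsTo hz)
  have h4 := div_mul_cancel₀ (z + -a) h1
  rw [← moebius_apply (-a) (neg_mem_disk ha) z, map_neg] at h4
  rw [moebius_apply, div_eq_iff h3]
  linear_combination h4

lemma moebius_neg_moebius (a : ℂ) (ha : a ∈ disk) {z : ℂ} (hz : z ∈ disk) :
    (moebius (-a) (neg_mem_disk ha)).toFun ((moebius a ha).toFun z) = z := by
  have h := moebius_moebius_neg (-a) (neg_mem_disk ha) hz
  simpa only [neg_neg] using h

lemma hasDerivAt_moebius (a : ℂ) (ha : a ∈ disk) {z : ℂ} (hz : z ∈ disk) :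
    HasDerivAt (moebius a ha).toFun
      ((1 - starRingEnd ℂ a * a) / (1 + starRingEnd ℂ a * z) ^ 2) z := by
  have hne := one_add_conj_mul_ne_zero ha hz
  have h1 : HasDerivAt (fun z => z + a) 1 z := (hasDerivAt_id z).add_const a
  have h2 : HasDerivAt (fun z => 1 + starRingEnd ℂ a * z) (starRingEnd ℂ a) z := by
    simpa using ((hasDerivAt_id z).const_mul (starRingEnd ℂ a)).const_add 1
  refine (h1.div h2 hne).congr_deriv ?_
  congr 1
  ring

/-- The change of variables formula for the area integral under an automorphism of the disk. -/
lemma lintegral_comp_moebius (a : ℂ) (ha : a ∈ disk) (g : ℂ → ℝ≥0∞) :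
    ∫⁻ z, g z ∂areaMeasure = ∫⁻ z, ‖deriv (moebius a ha).toFun z‖ₑ ^ 2 *
      g ((moebius a ha).toFun z) ∂areaMeasure := by
  set τ := (moebius a ha).toFun with hτ
  have himage : τ '' disk = disk := by
    refine Set.Subset.antisymm ?_ fun z hz => ?_
    · rintro _ ⟨z, hz, rfl⟩
      exact (moebius a ha).mapsTo hz
    · exact ⟨_, (moebius (-a) (neg_mem_disk ha)).mapsTo hz, moebius_moebius_neg a ha hz⟩
  have hinj : Set.InjOn τ disk := fun x hx y hy hxy => by
    rw [← moebius_neg_moebius a ha hx, ← moebius_neg_moebius a ha hy]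
    exact congrArg _ hxy
  have hchange := lintegral_image_eq_lintegral_abs_det_fderiv_mul volume
    isOpen_disk.measurableSet (f := τ)
    (f' := fun z => (ContinuousLinearMap.toSpanSingleton ℂ (deriv τ z)).restrictScalars ℝ)
    (fun z hz => by
      have h := (hasDerivAt_moebius a ha hz).differentiableAt.hasDerivAt.hasFDerivAt
      exact (h.restrictScalars ℝ).hasFDerivWithinAt) hinj g
  rw [himage] at hchange
  rw [areaMeasure, lintegral_smul_measure, lintegral_smul_measure, hchange]
  congr 1
  refine lintegral_congr fun z => ?_
  congr 1
  have hdet : ((ContinuousLinearMap.toSpanSingleton ℂ (deriv τ z)).restrictScalars ℝ).det =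
      ‖deriv τ z‖ ^ 2 := by
    simp [ContinuousLinearMap.det, LinearMap.det_restrictScalars, Algebra.norm_complex_eq,
      Complex.normSq_eq_norm_sq]
  rw [hdet, abs_of_nonneg (by positivity), ENNReal.ofReal_pow (norm_nonneg _), ofReal_norm]

lemma lintegral_areaMeasure_mono {f g : ℂ → ℝ≥0∞} (h : ∀ z ∈ disk, f z ≤ g z) :
    ∫⁻ z, f z ∂areaMeasure ≤ ∫⁻ z, g z ∂areaMeasure := by
  rw [areaMeasure, lintegral_smul_measure, lintegral_smul_measure]
  gcongr 1
  exact setLIntegral_mono' isOpen_disk.measurableSet h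

lemma areaSq_comp_moebius_le (a : ℂ) (ha : a ∈ disk) (f : ℂ → ℂ) :
    areaSq (fun z => f ((moebius a ha).toFun z)) ≤
      ENNReal.ofReal (16 / (1 - ‖a‖ ^ 2) ^ 2) * areaSq f := by
  rw [areaSq, areaSq, lintegral_comp_moebius a ha fun z => ‖f z‖ₑ ^ 2,
    ← lintegral_const_mul' _ _ ENNReal.ofReal_ne_top]
  refine lintegral_areaMeasure_mono fun z hz => ?_
  rw [← mul_assoc]
  refine le_mul_of_one_le_left' ?_
  have ha1 := norm_lt_one_of_mem ha
  have h1 : 0 < 1 - ‖a‖ ^ 2 := by nlinarith [norm_nonneg a]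
  have hnum : ‖(1 - starRingEnd ℂ a * a)‖ = 1 - ‖a‖ ^ 2 := by
    rw [Complex.conj_mul']
    norm_cast
    exact Real.norm_of_nonneg h1.le
  have hden : ‖1 + starRingEnd ℂ a * z‖ ≤ 2 := by
    refine (norm_add_le _ _).trans ?_
    have := norm_conj_mul_lt_one ha hz
    rw [norm_one]
    linarith
  have hden0 : 0 < ‖1 + starRingEnd ℂ a * z‖ := norm_pos_iff.2 (one_add_conj_mul_ne_zero ha hz)
  rw [(hasDerivAt_moebius a ha hz).deriv, ← ofReal_norm, ← ENNReal.ofReal_pow (norm_nonneg _),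
    ← ENNReal.ofReal_mul (by positivity), ENNReal.one_le_ofReal, norm_div, norm_pow, hnum,
    div_pow, div_mul_div_comm, le_div_iff₀ (by positivity), one_mul]
  have : (‖1 + starRingEnd ℂ a * z‖ ^ 2) ^ 2 ≤ (2 ^ 2) ^ 2 := by gcongr
  nlinarith [mul_pos h1 h1]

lemma dirichletIntegral_comp_moebius (a : ℂ) (ha : a ∈ disk) {f : ℂ → ℂ}
    (hf : DifferentiableOn ℂ f disk) :
    dirichletIntegral (fun z => f ((moebius a ha).toFun z)) = dirichletIntegral f := by
  have h : dirichletIntegral f = areaSq fun z =>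
      deriv (moebius a ha).toFun z * deriv f ((moebius a ha).toFun z) := by
    rw [dirichletIntegral, areaSq, areaSq, lintegral_comp_moebius a ha]
    simp only [enorm_mul, mul_pow]
  rw [h, dirichletIntegral]
  refine areaSq_congr fun z hz => ?_
  have h1 := (hasDerivAt_moebius a ha hz).differentiableAt.hasDerivAt
  have h2 := (hf.differentiableAt (isOpen_disk.mem_nhds ((moebius a ha).mapsTo hz))).hasDerivAt
  rw [mul_comm]
  exact (h2.comp z h1).deriv

lemma dirichletIntegral_congr {f g : ℂ → ℂ} (h : ∀ z ∈ disk, f z = g z) :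
    dirichletIntegral f = dirichletIntegral g :=
  areaSq_congr fun _ hz => Filter.EventuallyEq.deriv_eq <| by
    filter_upwards [isOpen_disk.mem_nhds hz] with w hw using h w hw

/-- `C` is a finite bound for the square of the norm of the composition operator on the space of
`N`. -/
def CompBound (N : ExtNorm) (φ : SelfMap) (C : ℝ≥0∞) : Prop :=
  C ≠ ∞ ∧ ∀ f : Hol, N.sq (comp φ f) ≤ C * N.sq f

lemma hardy_compBound {b : ℂ} (hb : b ∈ disk) (ψ : SelfMap) (hψ : ψ.toFun b = 0) :
    CompBound hardy ψ (4 * hardySq (szegoKernel b)) :=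
  ⟨ENNReal.mul_ne_top (by simp) (hardySq_szegoKernel_ne_top hb), fun f =>
    (hardySq_congr fun _ hz => comp_apply ψ f hz).trans_le (hardySq_comp_le hb ψ hψ f.2.1)⟩

lemma bergman_compBound (φ : SelfMap) (h0 : φ.toFun 0 = 0) :
    CompBound bergman φ (4 * hardySq (szegoKernel 0)) :=
  ⟨ENNReal.mul_ne_top (by simp) (hardySq_szegoKernel_ne_top zero_mem_disk), fun f =>
    (areaSq_congr fun _ hz => comp_apply φ f hz).trans_le (areaSq_comp_le φ h0 f.2.1)⟩

lemma hardy_moebius (a : ℂ) (ha : a ∈ disk) : ∃ C, CompBound hardy (moebius a ha) C :=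
  ⟨_, hardy_compBound (neg_mem_disk ha) _ (moebius_neg_self a ha)⟩

lemma bergman_moebius (a : ℂ) (ha : a ∈ disk) : ∃ C, CompBound bergman (moebius a ha) C :=
  ⟨_, ENNReal.ofReal_ne_top, fun f => (areaSq_congr fun _ hz =>
    comp_apply (moebius a ha) f hz).trans_le (areaSq_comp_moebius_le a ha f)⟩

lemma hardySq_le_dirichlet_sq (f : Hol) : hardySq f ≤ dirichlet.sq f := by
  have h1 := isWeighted_hardy.sq_eq f
  have h2 := isWeighted_dirichlet.sq_eq f
  change hardySq f = _ at h1
  rw [h1, h2]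
  refine ENNReal.tsum_le_tsum fun k => ?_
  gcongr
  exact le_max_left _ _

lemma dirichletAlt_moebius (a : ℂ) (ha : a ∈ disk) : ∃ C, CompBound dirichletAlt (moebius a ha) C := by
  obtain ⟨C, hC, h⟩ := hardy_moebius a ha
  refine ⟨max 1 C, by simp [hC], fun f => ?_⟩
  change hardySq _ + dirichletIntegral _ ≤ _ * (hardySq _ + dirichletIntegral _)
  rw [mul_add]
  refine add_le_add ((h f).trans (by gcongr; exacts [le_max_right _ _, le_rfl])) ?_
  rw [dirichletIntegral_congr fun _ hz => comp_apply (moebius a ha) f hz,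
    dirichletIntegral_comp_moebius a ha f.2.1]
  exact le_mul_of_one_le_left' (le_max_left _ _)

lemma dirichlet_moebius (a : ℂ) (ha : a ∈ disk) : ∃ C, CompBound dirichlet (moebius a ha) C := by
  obtain ⟨C, hC, h⟩ := hardy_moebius a ha
  refine ⟨C + 1, by simp [hC], fun f => ?_⟩
  rw [add_mul, one_mul]
  change ‖(comp (moebius a ha) f : ℂ → ℂ) 0‖ₑ ^ 2 + dirichletIntegral _ ≤ _
  refine add_le_add ?_ ?_
  · refine (enorm_eval_zero_sq_le_hardySq (comp (moebius a ha) f).2.1).trans ((h f).trans ?_)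
    gcongr
    exact hardySq_le_dirichlet_sq f
  · rw [dirichletIntegral_congr fun _ hz => comp_apply (moebius a ha) f hz,
      dirichletIntegral_comp_moebius a ha f.2.1]
    exact le_add_self

lemma CompBound.compBounded {N : ExtNorm} {φ : SelfMap} {C : ℝ≥0∞} (h : CompBound N φ C) :
    CompBounded N φ := by
  have hfin : ∀ f : N.Space, N.sq (comp φ f.toHol) ≠ ∞ := fun f =>
    ne_top_of_le_ne_top (ENNReal.mul_ne_top h.1 f.sq_ne_top) (h.2 _)
  let L : N.Space →ₗ[ℂ] N.Space :=
    { toFun := fun f => ExtNorm.Space.mk (comp φ f.toHol) (hfin f)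
      map_add' := fun f g => ExtNorm.Space.toHol_injective (by simp)
      map_smul' := fun c f => ExtNorm.Space.toHol_injective (by simp) }
  refine ⟨L.mkContinuous √(C.toReal) fun f => ?_, fun f => rfl⟩
  refine le_of_sq_le_sq ?_ (by positivity)
  rw [mul_pow, Real.sq_sqrt ENNReal.toReal_nonneg, ExtNorm.Space.norm_sq, ExtNorm.Space.norm_sq,
    ← ENNReal.toReal_mul]
  exact ENNReal.toReal_mono (ENNReal.mul_ne_top h.1 f.sq_ne_top) (h.2 _)

/-- The symbol `moebius (-φ 0) ∘ φ`, which fixes the origin. -/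
def SelfMap.centered (φ : SelfMap) : SelfMap where
  toFun z := (moebius (-φ.toFun 0) (neg_mem_disk (φ.mapsTo zero_mem_disk))).toFun (φ.toFun z)
  analytic := (moebius _ _).analytic.comp φ.analytic φ.mapsTo
  mapsTo := (moebius _ _).mapsTo.comp φ.mapsTo

lemma SelfMap.centered_zero (φ : SelfMap) : φ.centered.toFun 0 = 0 := by
  simp [centered, moebius_apply]

lemma comp_centered (φ : SelfMap) (f : Hol) : comp φ.centered f =
    comp φ (comp (moebius (-φ.toFun 0) (neg_mem_disk (φ.mapsTo zero_mem_disk))) f) := by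
  rw [← sub_eq_zero]
  refine hol_ext fun z hz => ?_
  change (comp _ _ : ℂ → ℂ) z - (comp _ _ : ℂ → ℂ) z = 0
  rw [comp_apply _ _ hz, comp_apply _ _ hz, comp_apply _ _ (φ.mapsTo hz)]
  exact sub_self _

lemma SelfMap.moebius_centered (φ : SelfMap) {z : ℂ} (hz : z ∈ disk) :
    (moebius (φ.toFun 0) (φ.mapsTo zero_mem_disk)).toFun (φ.centered.toFun z) = φ.toFun z :=
  moebius_moebius_neg _ _ (φ.mapsTo hz)

lemma comp_eq_comp_centered (φ : SelfMap) (f : Hol) : comp φ f =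
    comp φ.centered (comp (moebius (φ.toFun 0) (φ.mapsTo zero_mem_disk)) f) := by
  rw [← sub_eq_zero]
  refine hol_ext fun z hz => ?_
  change (comp _ _ : ℂ → ℂ) z - (comp _ _ : ℂ → ℂ) z = 0
  rw [comp_apply _ _ hz, comp_apply _ _ hz, comp_apply _ _ (φ.centered.mapsTo hz), φ.moebius_centered hz]
  exact sub_self _

lemma compBounded_of_centered {N : ExtNorm} (φ : SelfMap)
    (hN : ∃ C, CompBound N (moebius (φ.toFun 0) (φ.mapsTo zero_mem_disk)) C) {C' : ℝ≥0∞}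
    (hφ : CompBound N φ.centered C') : CompBounded N φ := by
  obtain ⟨C, hC, h⟩ := hN
  refine CompBound.compBounded (C := C' * C) ⟨ENNReal.mul_ne_top hφ.1 hC, fun f => ?_⟩
  rw [comp_eq_comp_centered φ f, mul_assoc]
  refine (hφ.2 _).trans ?_
  gcongr
  exact h f

lemma compBounded_hardy (φ : SelfMap) : CompBounded hardy φ :=
  compBounded_of_centered φ (hardy_moebius _ _)
    (hardy_compBound zero_mem_disk φ.centered φ.centered_zero)

lemma compBounded_bergman (φ : SelfMap) : CompBounded bergman φ :=
  compBounded_of_centered φ (bergman_moebius _ _) (bergman_compBound φ.centered φ.centered_zero)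

end Moebius

/-! ### Inequalities between geometric and arithmetic means -/

section Sequences

lemma prod_le_arith_mean_pow (z : ℕ → ℝ) (hz : ∀ j, 0 ≤ z j) (n : ℕ) :
    ∏ j ∈ Finset.range n, z j ≤ ((∑ j ∈ Finset.range n, z j) / n) ^ n := by
  rcases Nat.eq_zero_or_pos n with rfl | hn
  · simp
  have hn' : (n : ℝ) ≠ 0 := by exact_mod_cast hn.ne'
  have h := Real.geom_mean_le_arith_mean_weighted (Finset.range n) (fun _ => (1 / n : ℝ)) z
    (fun _ _ => by positivity) (by simp [hn']) (fun j _ => hz j)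
  rw [Real.finsetProd_rpow _ _ fun j _ => hz j, ← Finset.mul_sum] at h
  have hp : 0 ≤ ∏ j ∈ Finset.range n, z j := Finset.prod_nonneg fun j _ => hz j
  have h2 := pow_le_pow_left₀ (by positivity) h n
  rw [← Real.rpow_natCast (_ ^ _), ← Real.rpow_mul hp, one_div_mul_cancel hn', Real.rpow_one] at h2
  refine h2.trans (le_of_eq ?_)
  congr 1
  ring

lemma pow_le_pow_mul_prod {x y : ℕ → ℝ} {K : ℝ} (hy : ∀ j, 0 ≤ y j) (hanti : Antitone y)
    (h : ∀ n, ∏ j ∈ Finset.range n, y j ≤ K ^ n * ∏ j ∈ Finset.range n, x j) (n : ℕ) :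
    y n ^ (n + 1) ≤ K ^ (n + 1) * ∏ j ∈ Finset.range (n + 1), x j := by
  refine le_trans ?_ (h (n + 1))
  have := Finset.prod_le_prod (s := Finset.range (n + 1)) (f := fun _ => y n) (g := y)
    (fun _ _ => hy n) (fun j hj => hanti (by simpa [Nat.lt_succ_iff] using hj))
  simpa using this

/-- Geometric means of a null sequence are dominated by its arithmetic means, which tend to `0`. -/
lemma tendsto_zero_of_prod_le {x y : ℕ → ℝ} {K : ℝ} (hK : 0 ≤ K) (hx : ∀ j, 0 ≤ x j)
    (hy : ∀ j, 0 ≤ y j) (hanti : Antitone y)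
    (h : ∀ n, ∏ j ∈ Finset.range n, y j ≤ K ^ n * ∏ j ∈ Finset.range n, x j)
    (hlim : Filter.Tendsto x Filter.atTop (nhds 0)) :
    Filter.Tendsto y Filter.atTop (nhds 0) := by
  have hle : ∀ n, y n ≤ K * (((n + 1 : ℕ) : ℝ)⁻¹ * ∑ j ∈ Finset.range (n + 1), x j) := by
    intro n
    refine le_of_pow_le_pow_left₀ n.succ_ne_zero
      (mul_nonneg hK (mul_nonneg (by positivity) (Finset.sum_nonneg fun j _ => hx j))) ?_
    refine (pow_le_pow_mul_prod hy hanti h n).trans ?_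
    rw [mul_pow]
    gcongr
    refine (prod_le_arith_mean_pow x hx (n + 1)).trans (le_of_eq ?_)
    rw [div_eq_inv_mul]
  have hces := ((Filter.tendsto_add_atTop_iff_nat 1).2 hlim.cesaro).const_mul K
  rw [mul_zero] at hces
  exact squeeze_zero hy hle hces

/-- Carleman's inequality: a decreasing sequence is dominated by its geometric means, hence by `K`
times those of `x`, whose partial sums are bounded by those of `x`. -/
lemma sum_le_of_prod_le {x y : ℕ → ℝ} {K : ℝ} (hK : 0 ≤ K) (hx : ∀ j, 0 ≤ x j)
    (hy : ∀ j, 0 ≤ y j) (hanti : Antitone y)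
    (h : ∀ n, ∏ j ∈ Finset.range n, y j ≤ K ^ n * ∏ j ∈ Finset.range n, x j) (N : ℕ) :
    ∑ j ∈ Finset.range N, y j ≤ K * Real.exp 2 * ∑ j ∈ Finset.range N, x j := by
  set s : ℕ → ℝ := fun n => ∑ j ∈ Finset.range n, ((j : ℝ) + 1) * x j with hs
  have hs0 : ∀ n, 0 ≤ s n := fun n => Finset.sum_nonneg fun j _ =>
    mul_nonneg (by positivity) (hx j)
  -- the arithmetic-geometric mean inequality for the numbers `(j + 1) * x j`
  have hle : ∀ n : ℕ, y n ≤ K * Real.exp 2 * (s (n + 1) / (((n : ℝ) + 1) * (n + 2))) := by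
    intro n
    refine le_of_pow_le_pow_left₀ n.succ_ne_zero
      (mul_nonneg (by positivity) (div_nonneg (hs0 _) (by positivity))) ?_
    refine (pow_le_pow_mul_prod hy hanti h n).trans ?_
    have h1 := prod_le_arith_mean_pow (fun j => ((j : ℝ) + 1) * x j)
      (fun j => mul_nonneg (by positivity) (hx j)) (n + 1)
    have hfac : ∏ j ∈ Finset.range (n + 1), ((j : ℝ) + 1) = (n + 1).factorial := by
      rw [← Finset.prod_range_add_one_eq_factorial]
      push_cast
      rfl
    rw [Finset.prod_mul_distrib, hfac] at h1
    have h2 := Real.pow_div_factorial_le_exp (n + 2 : ℝ) (by positivity) (n + 1)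
    have hfpos : (0 : ℝ) < (n + 1).factorial := by exact_mod_cast Nat.factorial_pos _
    have h3 : ((n : ℝ) + 2) ^ (n + 1) ≤ Real.exp 2 ^ (n + 1) * (n + 1).factorial := by
      rw [div_le_iff₀ hfpos] at h2
      refine h2.trans ?_
      gcongr
      rw [← Real.exp_nat_mul]
      refine Real.exp_le_exp.2 ?_
      push_cast
      linarith [(Nat.cast_nonneg n : (0 : ℝ) ≤ n)]
    have hp0 : 0 ≤ ∏ j ∈ Finset.range (n + 1), x j := Finset.prod_nonneg fun j _ => hx j
    have h4 : ((n : ℝ) + 2) ^ (n + 1) * ∏ j ∈ Finset.range (n + 1), x j ≤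
        Real.exp 2 ^ (n + 1) * (s (n + 1) / ((n : ℝ) + 1)) ^ (n + 1) := by
      calc ((n : ℝ) + 2) ^ (n + 1) * ∏ j ∈ Finset.range (n + 1), x j
          ≤ Real.exp 2 ^ (n + 1) * (n + 1).factorial * ∏ j ∈ Finset.range (n + 1), x j := by gcongr
        _ = Real.exp 2 ^ (n + 1) * ((n + 1).factorial * ∏ j ∈ Finset.range (n + 1), x j) := by ring
        _ ≤ Real.exp 2 ^ (n + 1) * (s (n + 1) / ((n : ℝ) + 1)) ^ (n + 1) := by
          gcongr
          simpa [hs] using h1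
    rw [mul_comm (_ ^ _), ← le_div_iff₀ (by positivity)] at h4
    calc K ^ (n + 1) * ∏ j ∈ Finset.range (n + 1), x j
        ≤ K ^ (n + 1) * (Real.exp 2 ^ (n + 1) * (s (n + 1) / ((n : ℝ) + 1)) ^ (n + 1) /
          ((n : ℝ) + 2) ^ (n + 1)) := by gcongr
      _ = (K * Real.exp 2 * (s (n + 1) / (((n : ℝ) + 1) * (n + 2)))) ^ (n + 1) := by
        rw [← div_div, mul_pow, mul_pow, div_pow (_ / _)]
        ring
  -- summation over `n` telescopes, as `1 / ((n + 1) * (n + 2)) = 1 / (n + 1) - 1 / (n + 2)`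
  have htel : ∀ N : ℕ, ∑ n ∈ Finset.range N, s (n + 1) / (((n : ℝ) + 1) * (n + 2)) =
      ∑ j ∈ Finset.range N, x j - s N / (N + 1) := by
    intro N
    induction N with
    | zero => simp [hs]
    | succ N ih =>
      have hsucc : s (N + 1) = s N + ((N : ℝ) + 1) * x N := by
        simp only [hs]; rw [Finset.sum_range_succ]
      rw [Finset.sum_range_succ, ih, Finset.sum_range_succ, hsucc]
      push_cast
      field_simp
      ring
  calc ∑ j ∈ Finset.range N, y j
      ≤ ∑ n ∈ Finset.range N, K * Real.exp 2 * (s (n + 1) / (((n : ℝ) + 1) * (n + 2))) :=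
        Finset.sum_le_sum fun n _ => hle n
    _ = K * Real.exp 2 * (∑ j ∈ Finset.range N, x j - s N / (N + 1)) := by
        rw [← Finset.mul_sum, htel]
    _ ≤ K * Real.exp 2 * ∑ j ∈ Finset.range N, x j := by
        gcongr
        have : 0 ≤ s N / ((N : ℝ) + 1) := div_nonneg (hs0 N) (by positivity)
        linarith

end Sequences

/-! ### Compactness and approximation numbers -/

section Compactness

lemma isCompactOperator_of_rank_lt {E : Type} [NormedAddCommGroup E] [NormedSpace ℂ E]
    (R : E →L[ℂ] E) {n : ℕ} (hR : LinearMap.rank (R : E →ₗ[ℂ] E) < n) : IsCompactOperator R := by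
  have hfin : FiniteDimensional ℂ (LinearMap.range (R : E →ₗ[ℂ] E)) :=
    Module.rank_lt_aleph0_iff.1 (hR.trans Cardinal.natCast_lt_aleph0)
  have hid := isCompactOperator_id_iff_finiteDimensional (𝕜 := ℂ)
    (E := LinearMap.range (R : E →ₗ[ℂ] E)) |>.2 hfin
  let S : E →L[ℂ] LinearMap.range (R : E →ₗ[ℂ] E) :=
    R.codRestrict _ fun x => ⟨x, rfl⟩
  exact (hid.comp_clm S).clm_comp (LinearMap.range (R : E →ₗ[ℂ] E)).subtypeL

lemma isCompactOperator_of_tendsto_approxNumber {E : Type} [NormedAddCommGroup E]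
    [NormedSpace ℂ E] [CompleteSpace E] (T : E →L[ℂ] E)
    (h : Filter.Tendsto (approxNumber T) Filter.atTop (nhds 0)) : IsCompactOperator T := by
  have hex : ∀ m : ℕ, ∃ R : E →L[ℂ] E, IsCompactOperator R ∧ ‖T - R‖ ≤ 1 / ((m : ℝ) + 1) := by
    intro m
    have hpos : (0 : ℝ≥0∞) < ENNReal.ofReal (1 / ((m : ℝ) + 1)) :=
      ENNReal.ofReal_pos.2 (by positivity)
    obtain ⟨n, hn⟩ := (h.eventually_lt_const hpos).exists
    rw [approxNumber, iInf_lt_iff] at hn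
    obtain ⟨R, hR⟩ := hn
    rw [iInf_lt_iff] at hR
    obtain ⟨hR1, hR2⟩ := hR
    refine ⟨R, isCompactOperator_of_rank_lt R hR1, ?_⟩
    rw [← ofReal_norm] at hR2
    exact (ENNReal.ofReal_le_ofReal_iff (by positivity)).1 hR2.le
  choose R hR1 hR2 using hex
  refine isCompactOperator_of_tendsto (F := R) (l := Filter.atTop) ?_
    (Filter.Eventually.of_forall hR1)
  rw [tendsto_iff_norm_sub_tendsto_zero]
  refine squeeze_zero (fun _ => norm_nonneg _) (fun m => ?_) tendsto_one_div_add_atTop_nhds_zero_nat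
  rw [norm_sub_rev]
  exact hR2 m

/-- A compact operator with values in a Hilbert space is a limit of operators of finite rank. -/
lemma tendsto_approxNumber_of_isCompactOperator {H : Type} [NormedAddCommGroup H]
    [InnerProductSpace ℂ H] (T : H →L[ℂ] H) (hT : IsCompactOperator T) :
    Filter.Tendsto (approxNumber T) Filter.atTop (nhds 0) := by
  rw [ENNReal.tendsto_nhds_zero]
  intro ε hε
  obtain ⟨δ, hδ0, hδε⟩ : ∃ δ : ℝ, 0 < δ ∧ ENNReal.ofReal δ ≤ ε := by
    rcases eq_or_ne ε ∞ with rfl | htop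
    · exact ⟨1, one_pos, le_top⟩
    · exact ⟨ε.toReal, ENNReal.toReal_pos hε.ne' htop, (ENNReal.ofReal_toReal htop).le⟩
  obtain ⟨K, hK, hKT⟩ := hT.image_closedBall_subset_compact (f := (T : H →ₗ[ℂ] H)) 1
  obtain ⟨t, htfin, htK⟩ := Metric.totallyBounded_iff.1 hK.totallyBounded δ hδ0
  have hfd : FiniteDimensional ℂ (Submodule.span ℂ t) := FiniteDimensional.span_of_finite ℂ htfin
  set V := Submodule.span ℂ t with hV
  set R : H →L[ℂ] H := V.starProjection ∘L T with hR
  have hrank : LinearMap.rank (R : H →ₗ[ℂ] H) ≤ Module.finrank ℂ V := by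
    rw [Module.finrank_eq_rank]
    refine Submodule.rank_mono ?_
    rintro _ ⟨x, rfl⟩
    exact V.starProjection_apply_mem (T x)
  have hnorm : ‖T - R‖ ≤ δ := by
    refine ContinuousLinearMap.opNorm_le_of_unit_norm hδ0.le fun x hx => ?_
    obtain ⟨y, hy, hxy⟩ := Set.mem_iUnion₂.1 (htK (hKT ⟨x, by simp [hx], rfl⟩))
    have hxy' : ‖T x - y‖ < δ := by simpa [dist_eq_norm] using hxy
    refine le_trans ?_ hxy'.le
    have := V.starProjection_minimal (T x)
    change ‖T x - V.starProjection (T x)‖ ≤ _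
    rw [this]
    exact ciInf_le ⟨0, by rintro _ ⟨w, rfl⟩; exact norm_nonneg _⟩
      (⟨y, Submodule.subset_span hy⟩ : V)
  filter_upwards [Filter.eventually_gt_atTop (Module.finrank ℂ V)] with n hn
  refine (iInf₂_le R (hrank.trans_lt (by exact_mod_cast hn))).trans (le_trans ?_ hδε)
  rw [← ofReal_norm]
  exact ENNReal.ofReal_le_ofReal hnorm

namespace IsWeighted

variable {N : ExtNorm} {w : ℕ → ℝ}

lemma isCompactOperator_iff (h : IsWeighted N w) (T : N.Space →L[ℂ] N.Space) :
    IsCompactOperator T ↔ Filter.Tendsto (approxNumber T) Filter.atTop (nhds 0) := by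
  have hlim : Filter.Tendsto (approxNumber T) Filter.atTop (nhds 0) ↔
      Filter.Tendsto (approxNumber (h.conj T)) Filter.atTop (nhds 0) := by
    refine Filter.tendsto_congr' ?_
    filter_upwards [Filter.eventually_ge_atTop 1] with n hn using (h.approxNumber_conj T hn).symm
  rw [hlim]
  refine ⟨fun hT => tendsto_approxNumber_of_isCompactOperator _ ?_, fun hT => ?_⟩
  · exact (hT.comp_clm (h.toSeq.symm.toContinuousLinearEquiv : SeqSpace →L[ℂ] N.Space)).clm_comp
      (h.toSeq.toContinuousLinearEquiv : N.Space →L[ℂ] SeqSpace)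
  · have h1 := isCompactOperator_of_tendsto_approxNumber _ hT
    have h2 := (h1.comp_clm (h.toSeq.toContinuousLinearEquiv : N.Space →L[ℂ] SeqSpace)).clm_comp
      (h.toSeq.symm.toContinuousLinearEquiv : SeqSpace →L[ℂ] N.Space)
    refine (congrArg IsCompactOperator (funext fun x => ?_)).mp h2
    simp [conj]

end IsWeighted

end Compactness

/-! ### Comparison of composition operators -/

section Comparison

lemma IsCompOp.unique {N : ExtNorm} {φ : SelfMap} {S T : N.Space →L[ℂ] N.Space}
    (hS : IsCompOp N φ S) (hT : IsCompOp N φ T) : S = T := by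
  ext f
  exact ExtNorm.Space.toHol_injective ((hS f).trans (hT f).symm)

lemma IsCompOp.compApprox_eq {N : ExtNorm} {φ : SelfMap} {T : N.Space →L[ℂ] N.Space}
    (hT : IsCompOp N φ T) (n : ℕ) : compApprox N φ n = approxNumber T n :=
  le_antisymm (iInf₂_le T hT) (le_iInf₂ fun _ hS => by rw [hT.unique hS])

lemma IsCompOp.approxProd_eq {N : ExtNorm} {φ : SelfMap} {T : N.Space →L[ℂ] N.Space}
    (hT : IsCompOp N φ T) (n : ℕ) :
    approxProd N φ n = ∏ j ∈ Finset.Icc 1 n, approxNumber T j :=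
  Finset.prod_congr rfl fun j _ => hT.compApprox_eq j

lemma compApprox_eq_top {N : ExtNorm} {φ : SelfMap} (h : ¬ CompBounded N φ) (n : ℕ) :
    compApprox N φ n = ∞ := by
  simp only [compApprox, iInf_eq_top]
  exact fun T hT => absurd ⟨T, hT⟩ h

lemma approxProd_eq_top {N : ExtNorm} {φ : SelfMap} (h : ¬ CompBounded N φ) {n : ℕ}
    (hn : 1 ≤ n) : approxProd N φ n = ∞ := by
  rw [approxProd, Finset.prod_congr rfl fun j _ => compApprox_eq_top h j, Finset.prod_const,
    Nat.card_Icc, ENNReal.top_pow (by omega)]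

/-- The comparison for a symbol that fixes the origin. -/
theorem approxProd_le_of_weighted {N N' : ExtNorm} {w w' : ℕ → ℝ} (h : IsWeighted N w)
    (h' : IsWeighted N' w') (hmono : Monotone fun k => w k / w' k) {φ : SelfMap}
    (h0 : φ.toFun 0 = 0) (hb : CompBounded N' φ) {n : ℕ} (hn : 1 ≤ n) :
    approxProd N' φ n ≤ approxProd N φ n := by
  by_cases hbN : CompBounded N φ
  · obtain ⟨T, hT⟩ := hbN
    obtain ⟨T', hT'⟩ := hb
    rw [hT.approxProd_eq, hT'.approxProd_eq]
    exact prod_approxNumber_le_of_weighted h h' hmono h0 hT hT' n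
  · rw [approxProd_eq_top hbN hn]
    exact le_top

lemma compApprox_le_of_comp_eq {N : ExtNorm} {φ ψ σ : SelfMap}
    (hcomp : ∀ f, comp φ f = comp ψ (comp σ f)) {S : N.Space →L[ℂ] N.Space}
    (hS : IsCompOp N σ S) {K : ℝ≥0∞} (hK1 : 1 ≤ K) (hSK : ‖S‖ₑ ≤ K) {j : ℕ} (hj : 1 ≤ j) :
    compApprox N φ j ≤ K * compApprox N ψ j := by
  by_cases hb : CompBounded N ψ
  · obtain ⟨T, hT⟩ := hb
    have hTS : IsCompOp N φ (ContinuousLinearMap.id ℂ N.Space ∘L T ∘L S) := fun f => by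
      rw [hcomp, ← hS, ← hT]
      rfl
    rw [hTS.compApprox_eq, hT.compApprox_eq]
    refine (approxNumber_comp_le _ _ _ hj).trans ?_
    gcongr
    refine (mul_le_of_le_one_left' ?_).trans hSK
    rw [← ofReal_norm, ENNReal.ofReal_le_one]
    exact ContinuousLinearMap.norm_id_le
  · rw [compApprox_eq_top hb, ENNReal.mul_top (by positivity)]
    exact le_top

/-- Passing to the symbol that fixes the origin changes the approximation numbers by a bounded
factor depending only on the value of the symbol at the origin. -/
lemma exists_compApprox_centered_le {N : ExtNorm}
    (hN : ∀ a (ha : a ∈ disk), ∃ C, CompBound N (moebius a ha) C) {a : ℂ} (ha : a ∈ disk) :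
    ∃ K : ℝ≥0, ∀ φ : SelfMap, φ.toFun 0 = a → ∀ j, 1 ≤ j →
      compApprox N φ j ≤ K * compApprox N φ.centered j ∧
      compApprox N φ.centered j ≤ K * compApprox N φ j := by
  obtain ⟨C, hC⟩ := hN a ha
  obtain ⟨C', hC'⟩ := hN (-a) (neg_mem_disk ha)
  obtain ⟨S, hS⟩ := hC.compBounded
  obtain ⟨S', hS'⟩ := hC'.compBounded
  refine ⟨1 + ‖S‖₊ + ‖S'‖₊, fun φ hφ j hj => ?_⟩
  subst hφ
  have h1 : (1 : ℝ≥0∞) ≤ ((1 + ‖S‖₊ + ‖S'‖₊ : ℝ≥0) : ℝ≥0∞) := by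
    push_cast
    rw [add_assoc]
    exact le_self_add
  refine ⟨compApprox_le_of_comp_eq (comp_eq_comp_centered φ) hS h1 ?_ hj,
    compApprox_le_of_comp_eq (comp_centered φ) hS' h1 ?_ hj⟩
  · rw [enorm_eq_nnnorm]
    exact_mod_cast le_add_right le_add_self
  · rw [enorm_eq_nnnorm]
    exact_mod_cast le_add_self

lemma approxProd_le_pow_mul {N : ExtNorm} {φ ψ : SelfMap} {K : ℝ≥0∞}
    (h : ∀ j, 1 ≤ j → compApprox N φ j ≤ K * compApprox N ψ j) (n : ℕ) :
    approxProd N φ n ≤ K ^ n * approxProd N ψ n := by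
  have hcard : K ^ n = ∏ _j ∈ Finset.Icc 1 n, K := by simp
  rw [hcard, approxProd, approxProd, ← Finset.prod_mul_distrib]
  exact Finset.prod_le_prod' fun j hj => h j (Finset.mem_Icc.1 hj).1

/-- The comparison for a symbol with a prescribed value at the origin. -/
theorem exists_approxProd_le {N N' : ExtNorm} {w w' : ℕ → ℝ} (h : IsWeighted N w)
    (h' : IsWeighted N' w') (hmono : Monotone fun k => w k / w' k)
    (hN : ∀ a (ha : a ∈ disk), ∃ C, CompBound N (moebius a ha) C)
    (hN' : ∀ a (ha : a ∈ disk), ∃ C, CompBound N' (moebius a ha) C)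
    (hb : ∀ φ, CompBounded N' φ) {a : ℂ} (ha : a ∈ disk) :
    ∃ K : ℝ≥0, ∀ φ : SelfMap, φ.toFun 0 = a → ∀ n : ℕ, 1 ≤ n →
      approxProd N' φ n ≤ (K : ℝ≥0∞) ^ n * approxProd N φ n := by
  obtain ⟨K, hK⟩ := exists_compApprox_centered_le hN ha
  obtain ⟨K', hK'⟩ := exists_compApprox_centered_le hN' ha
  refine ⟨K' * K, fun φ hφ n hn => ?_⟩
  calc approxProd N' φ n ≤ (K' : ℝ≥0∞) ^ n * approxProd N' φ.centered n :=
        approxProd_le_pow_mul (fun j hj => (hK' φ hφ j hj).1) n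
    _ ≤ (K' : ℝ≥0∞) ^ n * approxProd N φ.centered n := by
        gcongr
        exact approxProd_le_of_weighted h h' hmono φ.centered_zero (hb _) hn
    _ ≤ (K' : ℝ≥0∞) ^ n * ((K : ℝ≥0∞) ^ n * approxProd N φ n) := by
        gcongr
        exact approxProd_le_pow_mul (fun j hj => (hK φ hφ j hj).2) n
    _ = ((K' * K : ℝ≥0) : ℝ≥0∞) ^ n * approxProd N φ n := by
        push_cast
        rw [mul_pow, mul_assoc]

section Transfer

variable {E E' : Type} [NormedAddCommGroup E] [NormedSpace ℂ E] [NormedAddCommGroup E']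
  [NormedSpace ℂ E'] {T : E →L[ℂ] E} {T' : E' →L[ℂ] E'} {K : ℝ≥0}

lemma prod_toReal_approxNumber (T : E →L[ℂ] E) (n : ℕ) :
    ∏ j ∈ Finset.range n, (approxNumber T (j + 1)).toReal =
      (∏ j ∈ Finset.Icc 1 n, approxNumber T j).toReal := by
  rw [ENNReal.toReal_prod, Finset.range_eq_Ico,
    Finset.prod_Ico_add' (fun j => (approxNumber T j).toReal) 0 n 1]
  rfl

lemma antitone_toReal_approxNumber (T : E →L[ℂ] E) :
    Antitone fun j => (approxNumber T (j + 1)).toReal := fun a b hab =>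
  ENNReal.toReal_mono (approxNumber_ne_top T (by omega)) (approxNumber_anti T (by omega))

lemma prod_toReal_le (h : ∀ n, 1 ≤ n → ∏ j ∈ Finset.Icc 1 n, approxNumber T' j ≤
      (K : ℝ≥0∞) ^ n * ∏ j ∈ Finset.Icc 1 n, approxNumber T j) (n : ℕ) :
    ∏ j ∈ Finset.range n, (approxNumber T' (j + 1)).toReal ≤
      (K : ℝ) ^ n * ∏ j ∈ Finset.range n, (approxNumber T (j + 1)).toReal := by
  rcases Nat.eq_zero_or_pos n with rfl | hn
  · simp
  rw [prod_toReal_approxNumber, prod_toReal_approxNumber]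
  have hfin : (K : ℝ≥0∞) ^ n * ∏ j ∈ Finset.Icc 1 n, approxNumber T j ≠ ∞ :=
    ENNReal.mul_ne_top (by simp) (ENNReal.prod_ne_top fun j hj =>
      approxNumber_ne_top T (Finset.mem_Icc.1 hj).1)
  simpa using ENNReal.toReal_mono hfin (h n hn)

lemma tendsto_approxNumber_iff (T : E →L[ℂ] E) :
    Filter.Tendsto (approxNumber T) Filter.atTop (nhds 0) ↔
      Filter.Tendsto (fun j => (approxNumber T (j + 1)).toReal) Filter.atTop (nhds 0) := by
  rw [← Filter.tendsto_add_atTop_iff_nat 1, ← ENNReal.toReal_zero,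
    ENNReal.tendsto_toReal_iff (fun n => approxNumber_ne_top T (by omega)) ENNReal.zero_ne_top]

lemma tendsto_approxNumber_of_prod_le
    (h : ∀ n, 1 ≤ n → ∏ j ∈ Finset.Icc 1 n, approxNumber T' j ≤
      (K : ℝ≥0∞) ^ n * ∏ j ∈ Finset.Icc 1 n, approxNumber T j)
    (hT : Filter.Tendsto (approxNumber T) Filter.atTop (nhds 0)) :
    Filter.Tendsto (approxNumber T') Filter.atTop (nhds 0) := by
  rw [tendsto_approxNumber_iff] at hT ⊢
  exact tendsto_zero_of_prod_le K.2 (fun _ => ENNReal.toReal_nonneg)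
    (fun _ => ENNReal.toReal_nonneg) (antitone_toReal_approxNumber T') (prod_toReal_le h) hT

lemma tsum_approxNumber_rpow_lt_top {p : ℝ} (hp : 0 < p)
    (h : ∀ n, 1 ≤ n → ∏ j ∈ Finset.Icc 1 n, approxNumber T' j ≤
      (K : ℝ≥0∞) ^ n * ∏ j ∈ Finset.Icc 1 n, approxNumber T j)
    (hT : ∑' n : ℕ, approxNumber T (n + 1) ^ p < ∞) :
    ∑' n : ℕ, approxNumber T' (n + 1) ^ p < ∞ := by
  have hrpow : ∀ {F : Type} [NormedAddCommGroup F] [NormedSpace ℂ F] (S : F →L[ℂ] F) (j : ℕ),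
      approxNumber S (j + 1) ^ p = ENNReal.ofReal ((approxNumber S (j + 1)).toReal ^ p) := by
    intro F _ _ S j
    rw [← ENNReal.ofReal_rpow_of_nonneg ENNReal.toReal_nonneg hp.le,
      ENNReal.ofReal_toReal (approxNumber_ne_top S (by omega))]
  simp_rw [hrpow] at hT ⊢
  set x : ℕ → ℝ := fun j => (approxNumber T (j + 1)).toReal ^ p with hx
  set y : ℕ → ℝ := fun j => (approxNumber T' (j + 1)).toReal ^ p with hy
  have hx0 : ∀ j, 0 ≤ x j := fun j => by positivity
  have hy0 : ∀ j, 0 ≤ y j := fun j => by positivity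
  have hxs : Summable x :=
    (ENNReal.summable_toReal hT.ne).congr fun j => ENNReal.toReal_ofReal (hx0 j)
  have hprod : ∀ n, ∏ j ∈ Finset.range n, y j ≤ ((K : ℝ) ^ p) ^ n * ∏ j ∈ Finset.range n, x j := by
    intro n
    have h1 := Real.rpow_le_rpow (Finset.prod_nonneg fun j _ => ENNReal.toReal_nonneg)
      (prod_toReal_le h n) hp.le
    rw [Real.mul_rpow (by positivity) (Finset.prod_nonneg fun j _ => ENNReal.toReal_nonneg),
      ← Real.finsetProd_rpow _ _ fun j _ => ENNReal.toReal_nonneg,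
      ← Real.finsetProd_rpow _ _ fun j _ => ENNReal.toReal_nonneg] at h1
    rwa [← Real.rpow_pow_comm K.coe_nonneg] at h1
  have hbound : ∀ N, ∑ j ∈ Finset.range N, y j ≤ (K : ℝ) ^ p * Real.exp 2 * ∑' j, x j := fun N =>
    (sum_le_of_prod_le (by positivity) hx0 hy0 (fun a b hab => Real.rpow_le_rpow
      ENNReal.toReal_nonneg (antitone_toReal_approxNumber T' hab) hp.le) hprod N).trans
      (by gcongr; exact hxs.sum_le_tsum _ fun j _ => hx0 j)
  have hys : Summable y := summable_of_sum_range_le hy0 hbound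
  rw [← ENNReal.ofReal_tsum_of_nonneg hy0 hys]
  exact ENNReal.ofReal_lt_top

end Transfer

/-- The comparison of compactness and of membership in the Schatten classes. -/
theorem compCompact_and_compSchatten_of_weighted {N N' : ExtNorm} {w w' : ℕ → ℝ}
    (h : IsWeighted N w) (h' : IsWeighted N' w') (hmono : Monotone fun k => w k / w' k)
    (hN : ∀ a (ha : a ∈ disk), ∃ C, CompBound N (moebius a ha) C)
    (hN' : ∀ a (ha : a ∈ disk), ∃ C, CompBound N' (moebius a ha) C)
    (hb : ∀ φ, CompBounded N' φ) (φ : SelfMap) :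
    (CompCompact N φ → CompCompact N' φ) ∧
      ∀ p : ℝ, 0 < p → CompSchatten N p φ → CompSchatten N' p φ := by
  obtain ⟨K, hK⟩ := exists_approxProd_le h h' hmono hN hN' hb (φ.mapsTo zero_mem_disk)
  obtain ⟨T', hT'⟩ := hb φ
  have hprod : ∀ T, IsCompOp N φ T → ∀ n, 1 ≤ n → ∏ j ∈ Finset.Icc 1 n, approxNumber T' j ≤
      (K : ℝ≥0∞) ^ n * ∏ j ∈ Finset.Icc 1 n, approxNumber T j := fun T hT n hn => by
    rw [← hT.approxProd_eq, ← hT'.approxProd_eq]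
    exact hK φ rfl n hn
  have hcompact : ∀ T, IsCompOp N φ T → IsCompactOperator T → IsCompactOperator T' :=
    fun T hT hc => (h'.isCompactOperator_iff T').2 <|
      tendsto_approxNumber_of_prod_le (hprod T hT) ((h.isCompactOperator_iff T).1 hc)
  refine ⟨?_, ?_⟩
  · rintro ⟨T, hT, hc⟩
    exact ⟨T', hT', hcompact T hT hc⟩
  · rintro p hp ⟨T, hT, hc, hs⟩
    exact ⟨T', hT', hcompact T hT hc, tsum_approxNumber_rpow_lt_top hp (hprod T hT) hs⟩

lemma monotone_hardy_div_bergman : Monotone fun k : ℕ => (1 : ℝ) / (1 / ((k : ℝ) + 1)) := by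
  intro a b hab
  have : (a : ℝ) ≤ b := by exact_mod_cast hab
  simpa using this

lemma monotone_dirichlet_div_hardy : Monotone fun k : ℕ => max 1 (k : ℝ) / 1 := by
  intro a b hab
  have : (a : ℝ) ≤ b := by exact_mod_cast hab
  simp only [div_one]
  exact max_le_max le_rfl this

lemma monotone_dirichletAlt_div_hardy : Monotone fun k : ℕ => ((k : ℝ) + 1) / 1 := by
  intro a b hab
  have : (a : ℝ) ≤ b := by exact_mod_cast hab
  simpa using this

end Comparison

end CompDisk

end

theorem theorem3p1 :
    -- boundedness on the Hardy and Bergman spaces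
    (∀ φ : CompDisk.SelfMap,
      CompDisk.CompBounded CompDisk.hardy φ ∧ CompDisk.CompBounded CompDisk.bergman φ) ∧
    -- the comparison of products
    (∀ φ : CompDisk.SelfMap, φ.toFun 0 = 0 → ∀ n : ℕ, 1 ≤ n →
      CompDisk.approxProd CompDisk.bergman φ n ≤ CompDisk.approxProd CompDisk.hardy φ n ∧
      CompDisk.approxProd CompDisk.hardy φ n ≤ CompDisk.approxProd CompDisk.dirichlet φ n ∧
      CompDisk.approxProd CompDisk.hardy φ n ≤ CompDisk.approxProd CompDisk.dirichletAlt φ n) ∧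
    -- the comparison when `0` is not fixed, with a constant depending only on the value at `0`
    (∀ a ∈ CompDisk.disk, ∃ K : ℝ≥0, ∀ φ : CompDisk.SelfMap, φ.toFun 0 = a → ∀ n : ℕ, 1 ≤ n →
      CompDisk.approxProd CompDisk.bergman φ n ≤
        (K : ℝ≥0∞) ^ n * CompDisk.approxProd CompDisk.hardy φ n ∧
      CompDisk.approxProd CompDisk.hardy φ n ≤
        (K : ℝ≥0∞) ^ n * CompDisk.approxProd CompDisk.dirichlet φ n ∧
      CompDisk.approxProd CompDisk.hardy φ n ≤
        (K : ℝ≥0∞) ^ n * CompDisk.approxProd CompDisk.dirichletAlt φ n) ∧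
    -- compactness and membership in Schatten classes
    (∀ φ : CompDisk.SelfMap,
      (CompDisk.CompCompact CompDisk.dirichlet φ → CompDisk.CompCompact CompDisk.hardy φ) ∧
      (CompDisk.CompCompact CompDisk.hardy φ → CompDisk.CompCompact CompDisk.bergman φ) ∧
      ∀ p : ℝ, 0 < p →
        (CompDisk.CompSchatten CompDisk.dirichlet p φ → CompDisk.CompSchatten CompDisk.hardy p φ) ∧
        (CompDisk.CompSchatten CompDisk.hardy p φ →
          CompDisk.CompSchatten CompDisk.bergman p φ)) := by
  open CompDisk in
  refine ⟨fun φ => ⟨compBounded_hardy φ, compBounded_bergman φ⟩, fun φ h0 n hn => ⟨?_, ?_, ?_⟩,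
    fun a ha => ?_, fun φ => ?_⟩
  · exact approxProd_le_of_weighted isWeighted_hardy isWeighted_bergman
      monotone_hardy_div_bergman h0 (compBounded_bergman φ) hn
  · exact approxProd_le_of_weighted isWeighted_dirichlet isWeighted_hardy
      monotone_dirichlet_div_hardy h0 (compBounded_hardy φ) hn
  · exact approxProd_le_of_weighted isWeighted_dirichletAlt isWeighted_hardy
      monotone_dirichletAlt_div_hardy h0 (compBounded_hardy φ) hn
  · obtain ⟨K₁, h₁⟩ := exists_approxProd_le isWeighted_hardy isWeighted_bergman
      monotone_hardy_div_bergman hardy_moebius bergman_moebius compBounded_bergman ha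
    obtain ⟨K₂, h₂⟩ := exists_approxProd_le isWeighted_dirichlet isWeighted_hardy
      monotone_dirichlet_div_hardy dirichlet_moebius hardy_moebius compBounded_hardy ha
    obtain ⟨K₃, h₃⟩ := exists_approxProd_le isWeighted_dirichletAlt isWeighted_hardy
      monotone_dirichletAlt_div_hardy dirichletAlt_moebius hardy_moebius compBounded_hardy ha
    have hle : ∀ {K L : ℝ≥0} {x y : ℝ≥0∞} {n : ℕ}, K ≤ L → x ≤ (K : ℝ≥0∞) ^ n * y →
        x ≤ (L : ℝ≥0∞) ^ n * y := fun hKL hx => hx.trans (by gcongr)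
    refine ⟨max K₁ (max K₂ K₃), fun φ hφ n hn => ⟨hle ?_ (h₁ φ hφ n hn), hle ?_ (h₂ φ hφ n hn),
      hle ?_ (h₃ φ hφ n hn)⟩⟩
    · exact le_max_left _ _
    · exact (le_max_left _ _).trans (le_max_right _ _)
    · exact (le_max_right _ _).trans (le_max_right _ _)
  · have hD := compCompact_and_compSchatten_of_weighted isWeighted_dirichlet isWeighted_hardy
      monotone_dirichlet_div_hardy dirichlet_moebius hardy_moebius compBounded_hardy φ
    have hH := compCompact_and_compSchatten_of_weighted isWeighted_hardy isWeighted_bergman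
      monotone_hardy_div_bergman hardy_moebius bergman_moebius compBounded_bergman φ
    exact ⟨hD.1, hH.1, fun p hp => ⟨hD.2 p hp, hH.2 p hp⟩⟩
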